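/- Let $F$ be a field of characteristic $2$. A \emph{totally singular quadratic form} over $F$ is a map $\varphi\colon V\to F$ on a finite-dimensional $F$-vector space $V$ such that $\varphi(av)=a^2\varphi(v)$ and $\varphi(v+w)=\varphi(v)+\varphi(w)$ for all $a\in F$, $v,w\in V$; its dimension is $\dim\varphi=\dim_F V$, and its \emph{defect} $i_{\mathrm{ql}}(\varphi)$ is the dimension of the $F$-subspace $\{v\in V:\varphi(v)=0\}$ (equivalently, the number $k$ in a decomposition $\varphi\simeq\sigma\perp k\times\langle 0\rangle$ with $\sigma$ anisotropic). For a field extension $E/F$, let $\varphi_E$ be the totally singular quadratic form over $E$ on $E\otimes_F V$ determined by additivity and $\varphi_E(e\otimes v)=e^2\varphi(v)$. Two totally singular quadratic forms $\varphi$ and $\psi$ over $F$ are \emph{Vishik equivalent} if $\dim\varphi=\dim\psi$ and $i_{\mathrm{ql}}(\varphi_E)=i_{\mathrm{ql}}(\psi_E)$ for every field extension $E/F$. They are \emph{similar} if there are $c\in F^*$ and a bijective $F$-linear map $f$ from the space of $\varphi$ to the space of $\psi$ such that $\varphi(v)=c\,\psi(f(v))$ for all $v$. Any two Vishik equivalent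 totally singular quadratic forms over $F$ of dimension at most $5$ are similar. -/

import Mathlib

universe u v w

open scoped TensorProduct

namespace TotSing

/-- A quadratic form is totally singular if its polar form `φ(x + y) - φ(x) - φ(y)` vanishes.
In characteristic two, these are exactly the quasilinear `2`-forms: the maps `φ : V → F` with
`φ(a v) = a² φ(v)` and `φ(v + w) = φ(v) + φ(w)`. -/
def IsTotallySingular {F : Type u} {V : Type v} [Field F] [AddCommGroup V] [Module F V]
    (φ : QuadraticForm F V) : Prop :=
  ∀ x y : V, QuadraticMap.polar φ x y = 0

/-- Two quadratic forms are similar if `φ ≃ c ψ` for some nonzero scalar `c`. -/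
def Similar {F : Type u} {V : Type v} {W : Type w} [Field F] [AddCommGroup V] [Module F V]
    [AddCommGroup W] [Module F W] (φ : QuadraticForm F V) (ψ : QuadraticForm F W) : Prop :=
  ∃ c : F, c ≠ 0 ∧ QuadraticMap.Equivalent φ (c • ψ)

/-- The defect (quasilinear index) of a quadratic form: the dimension of its radical
`{x | φ(x) = 0 and φ(x + y) = φ(y) for all y}`. For a totally singular form the radical is the
space of isotropic vectors together with `0`, and the defect is the number `k` in a decomposition
`φ ≃ σ ⊥ k × ⟨0⟩` with `σ` anisotropic; see `IsTotallySingular.mem_radical`,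
`IsTotallySingular.exists_decomposition` and `IsTotallySingular.defect_eq` below. -/
noncomputable def defect {F : Type u} {V : Type v} [Field F] [AddCommGroup V] [Module F V]
    (φ : QuadraticForm F V) : ℕ :=
  Module.finrank F φ.radical

section

variable {F : Type u} {V : Type v} [Field F] [AddCommGroup V] [Module F V]
  {φ : QuadraticForm F V}

theorem IsTotallySingular.map_add (hφ : IsTotallySingular φ) (x y : V) :
    φ (x + y) = φ x + φ y := by
  have h := hφ x y
  rw [QuadraticMap.polar, sub_sub, sub_eq_zero] at h
  exact h

theorem IsTotallySingular.mem_radical (hφ : IsTotallySingular φ) (x : V) :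
    x ∈ φ.radical ↔ φ x = 0 := by
  rw [QuadraticMap.mem_radical_iff']
  refine ⟨fun h => h.1, fun h => ⟨h, fun y => ?_⟩⟩
  rw [hφ.map_add, h, zero_add]

/-- A totally singular form is the orthogonal sum of an anisotropic form and the zero form on a
space of dimension `defect φ`. -/
theorem IsTotallySingular.exists_decomposition (hφ : IsTotallySingular φ) :
    ∃ S Z : Submodule F V, IsCompl S Z ∧ (∀ x ∈ S, φ x = 0 → x = 0) ∧ (∀ x ∈ Z, φ x = 0) ∧
      Module.finrank F Z = defect φ := by
  obtain ⟨S, hS⟩ := Submodule.exists_isCompl φ.radical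
  refine ⟨S, φ.radical, hS.symm, fun x hx h0 => ?_, fun x hx => (hφ.mem_radical x).1 hx, rfl⟩
  exact (Submodule.disjoint_def.1 hS.disjoint) x ((hφ.mem_radical x).2 h0) hx

/-- In every decomposition into an anisotropic part and a zero part, the latter has dimension
`defect φ`. -/
theorem IsTotallySingular.defect_eq (hφ : IsTotallySingular φ) {S Z : Submodule F V}
    (h : IsCompl S Z) (hS : ∀ x ∈ S, φ x = 0 → x = 0) (hZ : ∀ x ∈ Z, φ x = 0) :
    defect φ = Module.finrank F Z := by
  have hr : φ.radical = Z := by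
    ext x
    rw [hφ.mem_radical]
    refine ⟨fun hx => ?_, hZ x⟩
    obtain ⟨s, hs, z, hz, rfl⟩ := Submodule.mem_sup.1 (h.sup_eq_top ▸ Submodule.mem_top (x := x))
    rw [hφ.map_add, hZ z hz, add_zero] at hx
    rw [hS s hs hx, zero_add]
    exact hz
  rw [defect, hr]

end

section BaseChange

variable {F : Type u} {V : Type v} [Field F] [CharP F 2] [AddCommGroup V] [Module F V]
  {φ : QuadraticForm F V} (E : Type w) [Field E] [Algebra F E]

/-- The additive map `E ⊗ V → E` with `e ⊗ v ↦ e² φ(v)`, for a totally singular form `φ` over a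
field `F` of characteristic two and a field extension `E / F`. -/
noncomputable def IsTotallySingular.baseChangeAddHom (hφ : IsTotallySingular φ) :
    E ⊗[F] V →+ E :=
  haveI : CharP E 2 := charP_of_injective_algebraMap (algebraMap F E).injective 2
  TensorProduct.liftAddHom
    (AddMonoidHom.mk' (fun e : E => AddMonoidHom.mk' (fun x : V => e ^ 2 * algebraMap F E (φ x))
        (fun x y => by rw [hφ.map_add, RingHom.map_add, mul_add]))
      (fun a b => by
        ext x
        simp only [AddMonoidHom.mk'_apply, AddMonoidHom.add_apply, CharTwo.add_sq, add_mul]))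
    (fun r e x => by
      simp only [AddMonoidHom.mk'_apply, QuadraticMap.map_smul, Algebra.smul_def,
        Algebra.algebraMap_self, RingHom.id_apply, RingHom.map_mul]
      ring)

theorem IsTotallySingular.baseChangeAddHom_tmul (hφ : IsTotallySingular φ) (e : E) (x : V) :
    hφ.baseChangeAddHom E (e ⊗ₜ[F] x) = e ^ 2 * algebraMap F E (φ x) := by
  simp [IsTotallySingular.baseChangeAddHom]

theorem IsTotallySingular.baseChangeAddHom_smul (hφ : IsTotallySingular φ) (a : E)
    (t : E ⊗[F] V) :
    hφ.baseChangeAddHom E (a • t) = (a * a) • hφ.baseChangeAddHom E t := by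
  induction t using TensorProduct.induction_on with
  | zero => simp
  | tmul e x =>
    rw [TensorProduct.smul_tmul', baseChangeAddHom_tmul, baseChangeAddHom_tmul]
    simp only [smul_eq_mul]
    ring
  | add s t hs ht => rw [smul_add, AddMonoidHom.map_add, AddMonoidHom.map_add, hs, ht, smul_add]

/-- The scalar extension `φ_E` of a totally singular quadratic form `φ` over a field `F` of
characteristic two: the quadratic form over `E` on `E ⊗ V` that is additive and satisfies
`φ_E(e ⊗ v) = e² φ(v)`. (Mathlib's `QuadraticForm.baseChange` requires `2` to be invertible.) -/
noncomputable def IsTotallySingular.baseChange (hφ : IsTotallySingular φ) :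
    QuadraticForm E (E ⊗[F] V) where
  toFun := hφ.baseChangeAddHom E
  toFun_smul := hφ.baseChangeAddHom_smul E
  exists_companion' := ⟨0, fun s t => by simp⟩

theorem IsTotallySingular.baseChange_tmul (hφ : IsTotallySingular φ) (e : E) (x : V) :
    hφ.baseChange E (e ⊗ₜ[F] x) = e ^ 2 * algebraMap F E (φ x) :=
  hφ.baseChangeAddHom_tmul E e x

theorem IsTotallySingular.isTotallySingular_baseChange (hφ : IsTotallySingular φ) :
    IsTotallySingular (hφ.baseChange E) := by
  intro s t
  have h : hφ.baseChange E (s + t) = hφ.baseChange E s + hφ.baseChange E t :=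
    AddMonoidHom.map_add (hφ.baseChangeAddHom E) s t
  rw [QuadraticMap.polar, h]
  ring

end BaseChange

/-- Vishik equivalence of totally singular quadratic forms over a field `F` of characteristic two:
equal dimension, and equal defect over every field extension `E / F`. -/
def VishikEquivalent {F : Type u} {V : Type v} {W : Type w} [Field F] [CharP F 2]
    [AddCommGroup V] [Module F V] [AddCommGroup W] [Module F W]
    {φ : QuadraticForm F V} {ψ : QuadraticForm F W}
    (hφ : IsTotallySingular φ) (hψ : IsTotallySingular ψ) : Prop :=
  Module.finrank F V = Module.finrank F W ∧
    ∀ (E : Type u) [Field E] [Algebra F E],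
      defect (hφ.baseChange E) = defect (hψ.baseChange E)

end TotSing

namespace TotSing

open Module IntermediateField

/-! ### Subfields of an extension of exponent one. -/

section ExponentOne

variable {k L : Type*} [Field k] [Field L] [Algebra k L]

/-! Let `L` be `F` seen as an extension of `k = F` through Frobenius, so that all squares of `L` lie
in `k`. A totally singular form is then a `k`-linear map into `L` whose kernel is its radical. With
the dimension fixed, the form is determined up to isometry by its value space `A ⊆ L`, and
similarity means `A = cB`. The defects over `F` and over `F(√x)` determine `dim A` and `dim (A ∩
xA)` (`VishikEquivalent.sameType`); no other extensions are needed. It remains to show that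
subspaces of dimension at most 5 with these equal invariants (`SameType`) are proportional.

Scale so that `1 ∈ A` and `1 ∈ B`. Each `y ∈ B` is then a quotient of two elements of `A`, so a
subfield containing `A` contains `B`. If a multiple of `A` is a subfield, or a hyperplane in one of
degree 4, the claim follows from this and from the proportionality of hyperplanes
(`proportional_of_hyperplane`). If `dim A = 5` and `A` lies in a multiple of a field of degree 8,
then suitable multiples of `A` and `B` each contain a field of degree 4
(`ExponentOne.exists_scale_le`). The invariants force these two fields to coincide, and `A`, `B` are
compared directly (`SameType.proportional_of_field_le`). Otherwise `A` is as generic as possible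
(`Minimal₄`, `Minimal₅`). Any two `y, y' ∈ B` with `1, y, y'` independent then have a common
denominator `v`, that is `v, yv, y'v ∈ A` (`Minimal₄.exists_common`). Denominators are nearly unique
(`Minimal₄.div_mem`), so a single `v` serves all of `B`, and `vB = A`
(`SameType.proportional_of_minimal`). -/

/-- Every square of an element of `L` lies in `k`. -/
def ExponentOne (k L : Type*) [Field k] [Field L] [Algebra k L] : Prop :=
  ∀ x : L, x ^ 2 ∈ (⊥ : IntermediateField k L)

theorem ExponentOne.sq_mem (h : ExponentOne k L) (M : IntermediateField k L) (x : L) :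
    x ^ 2 ∈ M :=
  (bot_le : ⊥ ≤ M) (h x)

/-- In an extension of exponent one, adjoining `a` to `M` gives `M + M a`. -/
theorem ExponentOne.mem_sup_adjoin (h : ExponentOne k L) {M : IntermediateField k L} {a x : L} :
    x ∈ M ⊔ k⟮a⟯ ↔ ∃ m ∈ M, ∃ n ∈ M, m + n * a = x := by
  constructor
  · intro hx
    have mulc : ∀ x y : L, (∃ m ∈ M, ∃ n ∈ M, m + n * a = x) →
        (∃ m ∈ M, ∃ n ∈ M, m + n * a = y) → ∃ m ∈ M, ∃ n ∈ M, m + n * a = x * y := by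
      rintro _ _ ⟨m, hm, n, hn, rfl⟩ ⟨m', hm', n', hn', rfl⟩
      exact ⟨m * m' + n * n' * a ^ 2,
        M.add_mem (M.mul_mem hm hm') (M.mul_mem (M.mul_mem hn hn') (h.sq_mem M a)),
        m * n' + n * m', M.add_mem (M.mul_mem hm hn') (M.mul_mem hn hm'), by ring⟩
    let S : Subalgebra k L :=
      { carrier := {x | ∃ m ∈ M, ∃ n ∈ M, m + n * a = x}
        mul_mem' := fun {x y} hx hy => mulc x y hx hy
        add_mem' := by
          rintro _ _ ⟨m, hm, n, hn, rfl⟩ ⟨m', hm', n', hn', rfl⟩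
          exact ⟨m + m', M.add_mem hm hm', n + n', M.add_mem hn hn', by ring⟩
        algebraMap_mem' := fun r => ⟨algebraMap k L r, M.algebraMap_mem r, 0, M.zero_mem, by ring⟩ }
    let T : IntermediateField k L := S.toIntermediateField (by
      intro x hx
      have hx2 : (x ^ 2)⁻¹ ∈ M := M.inv_mem (h.sq_mem M x)
      -- Inverses come for free: `x ^ 2` is already invertible in `M`.
      have : x⁻¹ = (x ^ 2)⁻¹ * x := by
        rcases eq_or_ne x 0 with rfl | h0
        · simp
        · field_simp
      rw [this]
      exact mulc _ _ ⟨_, hx2, 0, M.zero_mem, by ring⟩ hx)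
    have hle : M ⊔ k⟮a⟯ ≤ T := by
      refine sup_le (fun m hm => ⟨m, hm, 0, M.zero_mem, by ring⟩) ?_
      rw [adjoin_simple_le_iff]
      exact ⟨0, M.zero_mem, 1, M.one_mem, by ring⟩
    exact hle hx
  · rintro ⟨m, hm, n, hn, rfl⟩
    have hM : M ≤ M ⊔ k⟮a⟯ := le_sup_left
    have ha : a ∈ M ⊔ k⟮a⟯ := (le_sup_right : k⟮a⟯ ≤ _) (mem_adjoin_simple_self k a)
    exact add_mem (hM hm) (mul_mem (hM hn) ha)

theorem mem_sup_adjoin_self (M : IntermediateField k L) (a : L) : a ∈ M ⊔ k⟮a⟯ :=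
  (le_sup_right : k⟮a⟯ ≤ _) (mem_adjoin_simple_self k a)

theorem mem_sup_adjoin_of_mem {M : IntermediateField k L} {x : L} (hx : x ∈ M) (a : L) :
    x ∈ M ⊔ k⟮a⟯ :=
  (le_sup_left : M ≤ _) hx

/-- The elements `1, a` are linearly independent over `M` if `a ∉ M`. -/
theorem eq_zero_of_add_mul_eq_zero {M : IntermediateField k L} {a m n : L} (ha : a ∉ M)
    (hm : m ∈ M) (hn : n ∈ M) (h : m + n * a = 0) : m = 0 ∧ n = 0 := by
  have hn0 : n = 0 := by
    by_contra h0
    apply ha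
    have : a = -m / n := by
      field_simp
      linear_combination h
    rw [this]
    exact M.div_mem (M.neg_mem hm) hn
  subst hn0
  simpa using h

/-- The map `M × M → L`, `(m, n) ↦ m + n a`. -/
noncomputable def pairMap (M : IntermediateField k L) (a : L) : M × M →ₗ[k] L :=
  M.val.toLinearMap.coprod (LinearMap.mulRight k a ∘ₗ M.val.toLinearMap)

theorem pairMap_apply (M : IntermediateField k L) (a : L) (p : M × M) :
    pairMap M a p = p.1 + p.2 * a := by
  simp [pairMap]

theorem ExponentOne.range_pairMap (h : ExponentOne k L) (M : IntermediateField k L) (a : L) :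
    LinearMap.range (pairMap M a) = Subalgebra.toSubmodule (M ⊔ k⟮a⟯).toSubalgebra := by
  ext x
  simp only [LinearMap.mem_range, Prod.exists, pairMap_apply]
  refine Iff.trans ?_ (Iff.trans h.mem_sup_adjoin.symm (Iff.rfl))
  exact ⟨fun ⟨m, n, e⟩ => ⟨m, m.2, n, n.2, e⟩, fun ⟨m, hm, n, hn, e⟩ => ⟨⟨m, hm⟩, ⟨n, hn⟩, e⟩⟩

theorem ExponentOne.finiteDimensional_sup_adjoin (h : ExponentOne k L)
    (M : IntermediateField k L) [FiniteDimensional k M] (a : L) :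
    FiniteDimensional k ↥(M ⊔ k⟮a⟯) := by
  have : FiniteDimensional k (LinearMap.range (pairMap M a)) := inferInstance
  rw [h.range_pairMap M a] at this
  exact this

theorem ExponentOne.finrank_sup_adjoin (h : ExponentOne k L) (M : IntermediateField k L)
    [FiniteDimensional k M] {a : L} (ha : a ∉ M) :
    finrank k ↥(M ⊔ k⟮a⟯) = 2 * finrank k M := by
  have hinj : Function.Injective (pairMap M a) := by
    rw [← LinearMap.ker_eq_bot, LinearMap.ker_eq_bot']
    rintro ⟨m, n⟩ e
    rw [pairMap_apply] at e
    obtain ⟨h1, h2⟩ := eq_zero_of_add_mul_eq_zero ha m.2 n.2 e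
    ext
    · exact h1
    · exact h2
  have h1 := LinearMap.finrank_range_of_inj hinj
  rw [h.range_pairMap M a, finrank_prod, ← two_mul] at h1
  exact h1

theorem sup_adjoin_eq_self {M : IntermediateField k L} {a : L} (ha : a ∈ M) : M ⊔ k⟮a⟯ = M :=
  sup_eq_left.2 (adjoin_simple_le_iff.2 ha)

/-! ### Multiples of subspaces and the type of a subspace. -/

/-- The submodule underlying an intermediate field. -/
def toSub (M : IntermediateField k L) : Submodule k L := Subalgebra.toSubmodule M.toSubalgebra

@[simp] theorem mem_toSub {M : IntermediateField k L} {x : L} : x ∈ toSub M ↔ x ∈ M := Iff.rfl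

theorem finrank_toSub (M : IntermediateField k L) : finrank k (toSub M) = finrank k M := rfl

instance finiteDimensional_toSub (M : IntermediateField k L) [h : FiniteDimensional k M] :
    FiniteDimensional k (toSub M) := h

/-- The multiple `c A` of a subspace. -/
def scale (c : L) (A : Submodule k L) : Submodule k L := A.map (LinearMap.mulLeft k c)

theorem mul_mem_scale {c x : L} {A : Submodule k L} (hx : x ∈ A) : c * x ∈ scale c A :=
  Submodule.mem_map_of_mem (f := LinearMap.mulLeft k c) hx

theorem mem_scale {c : L} (hc : c ≠ 0) {A : Submodule k L} {x : L} :
    x ∈ scale c A ↔ c⁻¹ * x ∈ A := by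
  constructor
  · rintro ⟨y, hy, rfl⟩
    simpa [hc] using hy
  · intro h
    have := mul_mem_scale (c := c) h
    rwa [mul_inv_cancel_left₀ hc] at this

theorem scale_scale (c d : L) (A : Submodule k L) : scale c (scale d A) = scale (c * d) A := by
  rw [scale, scale, scale, ← Submodule.map_comp, LinearMap.mulLeft_mul]

theorem scale_one (A : Submodule k L) : scale 1 A = A := by
  rw [scale, LinearMap.mulLeft_one, Submodule.map_id]

instance finiteDimensional_scale (c : L) (A : Submodule k L) [FiniteDimensional k A] :
    FiniteDimensional k (scale c A) :=
  inferInstanceAs (FiniteDimensional k (A.map (LinearMap.mulLeft k c)))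

theorem finrank_scale {c : L} (hc : c ≠ 0) (A : Submodule k L) :
    finrank k (scale c A) = finrank k A :=
  (Submodule.equivMapOfInjective (LinearMap.mulLeft k c) (mul_right_injective₀ hc) A).finrank_eq.symm

theorem scale_mono (c : L) {A B : Submodule k L} (h : A ≤ B) : scale c A ≤ scale c B :=
  Submodule.map_mono h

/-- The subspace of all `v ∈ A` with `x v ∈ A`. -/
def selfInter (x : L) (A : Submodule k L) : Submodule k L := A ⊓ A.comap (LinearMap.mulLeft k x)

theorem mem_selfInter {x v : L} {A : Submodule k L} : v ∈ selfInter x A ↔ v ∈ A ∧ x * v ∈ A :=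
  Iff.rfl

theorem selfInter_le (x : L) (A : Submodule k L) : selfInter x A ≤ A := inf_le_left

instance finiteDimensional_selfInter (x : L) (A : Submodule k L) [FiniteDimensional k A] :
    FiniteDimensional k (selfInter x A) :=
  Submodule.finiteDimensional_of_le (selfInter_le x A)

theorem selfInter_scale {c : L} (hc : c ≠ 0) (x : L) (A : Submodule k L) :
    selfInter x (scale c A) = scale c (selfInter x A) := by
  ext v
  rw [mem_selfInter, mem_scale hc, mem_scale hc, mem_scale hc, mem_selfInter, mul_left_comm]

/-- Two subspaces of the same dimension whose intersections with their multiples have the same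
dimensions. -/
def SameType (A B : Submodule k L) : Prop :=
  finrank k A = finrank k B ∧
    ∀ x : L, finrank k (selfInter x A) = finrank k (selfInter x B)

theorem SameType.symm {A B : Submodule k L} (h : SameType A B) : SameType B A :=
  ⟨h.1.symm, fun x => (h.2 x).symm⟩

theorem SameType.trans {A B C : Submodule k L} (h : SameType A B) (h' : SameType B C) :
    SameType A C :=
  ⟨h.1.trans h'.1, fun x => (h.2 x).trans (h'.2 x)⟩

theorem sameType_scale {c : L} (hc : c ≠ 0) (A : Submodule k L) : SameType (scale c A) A :=
  ⟨finrank_scale hc A, fun x => by rw [selfInter_scale hc, finrank_scale hc]⟩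

/-- Two subspaces are proportional if one is a nonzero multiple of the other. -/
def Proportional (A B : Submodule k L) : Prop := ∃ c : L, c ≠ 0 ∧ A = scale c B

theorem Proportional.symm {A B : Submodule k L} (h : Proportional A B) : Proportional B A := by
  obtain ⟨c, hc, rfl⟩ := h
  exact ⟨c⁻¹, inv_ne_zero hc, by rw [scale_scale, inv_mul_cancel₀ hc, scale_one]⟩

theorem Proportional.trans {A B C : Submodule k L} (h : Proportional A B)
    (h' : Proportional B C) : Proportional A C := by
  obtain ⟨c, hc, rfl⟩ := h
  obtain ⟨d, hd, rfl⟩ := h'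
  exact ⟨c * d, mul_ne_zero hc hd, scale_scale c d C⟩

theorem Proportional.refl (A : Submodule k L) : Proportional A A :=
  ⟨1, one_ne_zero, (scale_one A).symm⟩

theorem proportional_scale {c : L} (hc : c ≠ 0) (A : Submodule k L) :
    Proportional (scale c A) A :=
  ⟨c, hc, rfl⟩

/-- To prove that two subspaces are proportional one may replace both by multiples. -/
theorem proportional_of_scale {A B : Submodule k L} {c d : L} (hc : c ≠ 0) (hd : d ≠ 0)
    (h : Proportional (scale c A) (scale d B)) : Proportional A B :=
  ((proportional_scale hc A).symm.trans h).trans (proportional_scale hd B)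

theorem SameType.scale_both {A B : Submodule k L} {c d : L} (hc : c ≠ 0) (hd : d ≠ 0)
    (h : SameType A B) : SameType (scale c A) (scale d B) :=
  ((sameType_scale hc A).trans h).trans (sameType_scale hd B).symm

theorem one_mem_scale_inv {a : L} (ha : a ≠ 0) {A : Submodule k L} (h : a ∈ A) :
    (1 : L) ∈ scale a⁻¹ A := by
  rw [mem_scale (inv_ne_zero ha), inv_inv, mul_one]
  exact h

/-- The main way the type is used: with `v = 1` it writes each `x ∈ B` as a quotient of two elements
of `A`. -/
theorem SameType.exists_ratio {A B : Submodule k L} [FiniteDimensional k A]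
    [FiniteDimensional k B] (h : SameType A B) {x v : L} (hv : v ≠ 0) (hvB : v ∈ B)
    (hxv : x * v ∈ B) : ∃ w : L, w ≠ 0 ∧ w ∈ A ∧ x * w ∈ A := by
  have hne : selfInter x A ≠ ⊥ := by
    intro h0
    have h1 := h.2 x
    rw [h0, finrank_bot, eq_comm, Submodule.finrank_eq_zero] at h1
    exact hv ((Submodule.mem_bot k).1 (h1 ▸ mem_selfInter.2 ⟨hvB, hxv⟩))
  obtain ⟨w, hw, hw0⟩ := Submodule.exists_mem_ne_zero_of_ne_bot hne
  exact ⟨w, hw0, hw.1, hw.2⟩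

theorem SameType.le_toSub {A B : Submodule k L} [FiniteDimensional k A]
    [FiniteDimensional k B] (h : SameType A B) (hB : (1 : L) ∈ B) {M : IntermediateField k L}
    (hA : A ≤ toSub M) : B ≤ toSub M := by
  intro b hb
  obtain ⟨w, hw0, hw, hbw⟩ := h.exists_ratio one_ne_zero hB ((mul_one b).symm ▸ hb)
  have : b = b * w / w := by field_simp
  rw [mem_toSub, this]
  exact M.div_mem (hA hbw) (hA hw)

/-- A subspace of the same type as an intermediate field is a multiple of it. -/
theorem SameType.proportional_of_eq_toSub {A B : Submodule k L} [FiniteDimensional k A]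
    [FiniteDimensional k B] (h : SameType A B) (hB : (1 : L) ∈ B) {M : IntermediateField k L}
    (hA : A = toSub M) : Proportional A B := by
  have hle := h.le_toSub hB hA.le
  rw [← hA] at hle
  rw [Submodule.eq_of_le_of_finrank_eq hle h.1.symm]
  exact Proportional.refl A

end ExponentOne

/-! ### Minimal subspaces. -/

section Minimal

variable {k L : Type*} [Field k] [Field L] [Algebra k L]

/-- The subfield generated by two elements. -/
def adj₂ (k : Type*) {L : Type*} [Field k] [Field L] [Algebra k L] (x y : L) :
    IntermediateField k L :=
  k⟮x⟯ ⊔ k⟮y⟯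

/-- The subfield generated by three elements. -/
def adj₃ (k : Type*) {L : Type*} [Field k] [Field L] [Algebra k L] (x y z : L) :
    IntermediateField k L :=
  adj₂ k x y ⊔ k⟮z⟯

theorem left_mem_adj₂ (x y : L) : x ∈ adj₂ k x y :=
  mem_sup_adjoin_of_mem (mem_adjoin_simple_self k x) y

theorem right_mem_adj₂ (x y : L) : y ∈ adj₂ k x y := mem_sup_adjoin_self _ y

theorem ExponentOne.mem_adjoin (h : ExponentOne k L) {a x : L} :
    x ∈ k⟮a⟯ ↔ ∃ m n : k, algebraMap k L m + algebraMap k L n * a = x := by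
  have := h.mem_sup_adjoin (M := ⊥) (a := a) (x := x)
  rw [bot_sup_eq] at this
  rw [this]
  constructor
  · rintro ⟨m, hm, n, hn, e⟩
    obtain ⟨m, rfl⟩ := mem_bot.1 hm
    obtain ⟨n, rfl⟩ := mem_bot.1 hn
    exact ⟨m, n, e⟩
  · rintro ⟨m, n, e⟩
    exact ⟨_, mem_bot.2 ⟨m, rfl⟩, _, mem_bot.2 ⟨n, rfl⟩, e⟩

theorem mul_mem_scale_toSub (c : L) {M : IntermediateField k L} {x : L} (hx : x ∈ M) :
    c * x ∈ scale c (toSub M) :=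
  mul_mem_scale (A := toSub M) hx

theorem mul_mem_of_mem_bot {M : Submodule k L} {c : L} (hc : c ∈ (⊥ : IntermediateField k L))
    {x : L} (hx : x ∈ M) : c * x ∈ M := by
  obtain ⟨r, rfl⟩ := mem_bot.1 hc
  rw [← Algebra.smul_def]
  exact M.smul_mem r hx

/-- No four linearly independent elements of `A` lie in a multiple of a field generated by two
elements. -/
def Minimal₄ (A : Submodule k L) : Prop :=
  ∀ a b c d : L, a ∈ A → b ∈ A → c ∈ A → d ∈ A → LinearIndependent k ![a, b, c, d] →
    ∀ t x y : L, t ≠ 0 → ¬ (a ∈ scale t (toSub (adj₂ k x y)) ∧ b ∈ scale t (toSub (adj₂ k x y)) ∧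
      c ∈ scale t (toSub (adj₂ k x y)) ∧ d ∈ scale t (toSub (adj₂ k x y)))

/-- `A` does not lie in a multiple of a field generated by three elements. -/
def Minimal₅ (A : Submodule k L) : Prop :=
  ∀ t x y z : L, t ≠ 0 → ¬ A ≤ scale t (toSub (adj₃ k x y z))

theorem Minimal₄.scaled {A : Submodule k L} (h : Minimal₄ A) {s : L} (hs : s ≠ 0) :
    Minimal₄ (scale s A) := by
  rintro a b c d ha hb hc hd hi t x y ht ⟨ha', hb', hc', hd'⟩
  rw [mem_scale hs] at ha hb hc hd
  refine h _ _ _ _ ha hb hc hd ?_ (s⁻¹ * t) x y (mul_ne_zero (inv_ne_zero hs) ht) ?_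
  · have := hi.map' (LinearMap.mulLeft k s⁻¹)
      (LinearMap.ker_eq_bot.2 (mul_right_injective₀ (inv_ne_zero hs)))
    have e : LinearMap.mulLeft k s⁻¹ ∘ ![a, b, c, d] =
        ![s⁻¹ * a, s⁻¹ * b, s⁻¹ * c, s⁻¹ * d] := by
      ext i
      fin_cases i <;> rfl
    rwa [e] at this
  · rw [← scale_scale]
    exact ⟨mul_mem_scale ha', mul_mem_scale hb', mul_mem_scale hc', mul_mem_scale hd'⟩

theorem Minimal₅.scaled {A : Submodule k L} (h : Minimal₅ A) {s : L} (hs : s ≠ 0) :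
    Minimal₅ (scale s A) := by
  intro t x y z ht hle
  refine h (s⁻¹ * t) x y z (mul_ne_zero (inv_ne_zero hs) ht) ?_
  have := scale_mono s⁻¹ hle
  rwa [scale_scale, scale_scale, inv_mul_cancel₀ hs, scale_one] at this

/-- Four vectors are linearly independent if the pairs `a, b` and `c, d` are independent and span
subspaces with trivial intersection. -/
theorem linearIndependent_four {a b c d : L} (hab : ∀ s t : k, s • a + t • b = 0 → s = 0 ∧ t = 0)
    (hcd : ∀ s t : k, s • c + t • d = 0 → s = 0 ∧ t = 0)
    (hdis : ∀ s t s' t' : k, s • a + t • b = s' • c + t' • d → s • a + t • b = 0) :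
    LinearIndependent k ![a, b, c, d] := by
  rw [Fintype.linearIndependent_iff]
  intro g hg
  simp only [Fin.sum_univ_four, Matrix.cons_val] at hg
  have h1 := hdis (g 0) (g 1) (-g 2) (-g 3) (by
    rw [neg_smul, neg_smul]; linear_combination (exp := 1) hg)
  obtain ⟨h0, h1'⟩ := hab _ _ h1
  obtain ⟨h2, h3⟩ := hcd (g 2) (g 3) (by rw [h0, h1'] at hg; simpa using hg)
  intro i
  fin_cases i <;> assumption

theorem pair_indep {y : L} (hy : y ∉ (⊥ : IntermediateField k L)) {v : L} (hv : v ≠ 0) (s t : k)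
    (h : s • v + t • (y * v) = 0) : s = 0 ∧ t = 0 := by
  have h1 : algebraMap k L s + algebraMap k L t * y = 0 := by
    apply mul_right_cancel₀ hv
    rw [Algebra.smul_def, Algebra.smul_def] at h
    linear_combination h
  have := eq_zero_of_add_mul_eq_zero hy (mem_bot.2 ⟨s, rfl⟩) (mem_bot.2 ⟨t, rfl⟩) h1
  simpa using this

/-- In a minimal subspace the elements `v` with `v, y v ∈ A` all lie on a line over `k(y)`. -/
theorem Minimal₄.div_mem (h : ExponentOne k L) {A : Submodule k L} (hA : Minimal₄ A) {u v y : L}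
    (hu0 : u ≠ 0) (hu : u ∈ A) (hyu : y * u ∈ A) (hv : v ∈ A) (hyv : y * v ∈ A)
    (hy : y ∉ (⊥ : IntermediateField k L)) : v / u ∈ k⟮y⟯ := by
  by_contra hvu
  have hv0 : v ≠ 0 := by
    rintro rfl
    exact hvu (by simp)
  refine hA u (y * u) v (y * v) hu hyu hv hyv ?_ u y (v / u) hu0 ?_
  · refine linearIndependent_four (pair_indep hy hu0) (pair_indep hy hv0) ?_
    intro s t s' t' e
    simp only [Algebra.smul_def] at e ⊢
    have hmem : ∀ s t : k, algebraMap k L s + algebraMap k L t * y ∈ k⟮y⟯ :=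
      fun s t => h.mem_adjoin.2 ⟨s, t, rfl⟩
    have e1 : (algebraMap k L s + algebraMap k L t * y) +
        (-(algebraMap k L s' + algebraMap k L t' * y)) * (v / u) = 0 := by
      field_simp
      linear_combination e
    have := (eq_zero_of_add_mul_eq_zero hvu (hmem s t) (neg_mem (hmem s' t')) e1).1
    linear_combination u * this
  · have h1 := left_mem_adj₂ (k := k) y (v / u)
    have h2 := right_mem_adj₂ (k := k) y (v / u)
    have e : v = u * (v / u) := by field_simp
    refine ⟨?_, ?_, ?_, ?_⟩
    · simpa using mul_mem_scale_toSub u (one_mem (adj₂ k y (v / u)))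
    · rw [mul_comm]
      exact mul_mem_scale_toSub u h1
    · have := mul_mem_scale_toSub u h2
      rwa [← e] at this
    · have : y * v = u * (y * (v / u)) := by field_simp
      rw [this]
      exact mul_mem_scale_toSub u (mul_mem h1 h2)

/-- If `y' ∉ k(x)` and `z ∉ k(x, y')` for `x = y + y'`, then `1, y, z, y' z` are linearly
independent over `k(x)`. -/
theorem coeff_eq_zero {y y' z g₀ g₁ g₂ g₃ : L} (hy' : y' ∉ k⟮y + y'⟯)
    (hz : z ∉ adj₂ k (y + y') y') (h₀ : g₀ ∈ k⟮y + y'⟯) (h₁ : g₁ ∈ k⟮y + y'⟯)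
    (h₂ : g₂ ∈ k⟮y + y'⟯) (h₃ : g₃ ∈ k⟮y + y'⟯)
    (e : g₀ + g₁ * y + g₂ * z + g₃ * (y' * z) = 0) : g₀ = 0 ∧ g₁ = 0 ∧ g₂ = 0 ∧ g₃ = 0 := by
  have hx : y + y' ∈ k⟮y + y'⟯ := mem_adjoin_simple_self k _
  have up : ∀ {g : L}, g ∈ k⟮y + y'⟯ → g ∈ adj₂ k (y + y') y' :=
    fun hg => mem_sup_adjoin_of_mem hg y'
  have hy'2 : y' ∈ adj₂ k (y + y') y' := right_mem_adj₂ _ _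
  have hy2 : y ∈ adj₂ k (y + y') y' := by
    have := sub_mem (left_mem_adj₂ (k := k) (y + y') y') hy'2
    simpa using this
  obtain ⟨e1, e2⟩ := eq_zero_of_add_mul_eq_zero (m := g₀ + g₁ * y) (n := g₂ + g₃ * y') hz
    (add_mem (up h₀) (mul_mem (up h₁) hy2)) (add_mem (up h₂) (mul_mem (up h₃) hy'2))
    (by linear_combination e)
  obtain ⟨e3, e4⟩ := eq_zero_of_add_mul_eq_zero hy' h₂ h₃ e2
  -- Put `y = x - y'` with `x = y + y'` and compare coefficients of `1, y'` over `k(x)`.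
  obtain ⟨e5, e6⟩ := eq_zero_of_add_mul_eq_zero (m := g₀ + g₁ * (y + y')) (n := -g₁) hy'
    (add_mem h₀ (mul_mem h₁ hx)) (neg_mem h₁) (by linear_combination e1)
  rw [neg_eq_zero] at e6
  subst e6
  exact ⟨by simpa using e5, rfl, e3, e4⟩

/-- A hyperplane is complemented by any element outside it. -/
theorem exists_add_smul {U A : Submodule k L} [FiniteDimensional k A] (hUA : U ≤ A)
    (hd : finrank k A ≤ finrank k U + 1) {e : L} (he : e ∈ A) (heU : e ∉ U) {a : L} (ha : a ∈ A) :
    ∃ u ∈ U, ∃ t : k, u + t • e = a := by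
  have : FiniteDimensional k U := Submodule.finiteDimensional_of_le hUA
  have hle : U ⊔ k ∙ e ≤ A := sup_le hUA ((Submodule.span_singleton_le_iff_mem e A).2 he)
  have hlt : U < U ⊔ k ∙ e := by
    refine lt_of_le_of_ne le_sup_left fun h => heU ?_
    rw [h]
    exact (le_sup_right : k ∙ e ≤ _) (Submodule.mem_span_singleton_self e)
  have h1 := Submodule.finrank_lt_finrank_of_lt hlt
  have h2 := Submodule.eq_of_le_of_finrank_le hle (by omega)
  rw [← h2] at ha
  obtain ⟨u, hu, w, hw, rfl⟩ := Submodule.mem_sup.1 ha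
  obtain ⟨t, rfl⟩ := Submodule.mem_span_singleton.1 hw
  exact ⟨u, hu, t, rfl⟩

end Minimal

/-! ### Common denominators in the minimal case. -/

section Minimal

variable {k L : Type*} [Field k] [Field L] [Algebra k L]

theorem finrank_span_four {a b c d : L} (h : LinearIndependent k ![a, b, c, d]) :
    finrank k (Submodule.span k (Set.range ![a, b, c, d])) = 4 := by
  rw [finrank_span_eq_card h, Fintype.card_fin]

theorem mem_span_four {a b c d x : L} :
    x ∈ Submodule.span k (Set.range ![a, b, c, d]) ↔
      ∃ p q r s : k, p • a + q • b + r • c + s • d = x := by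
  rw [Submodule.mem_span_range_iff_exists_fun]
  simp only [Fin.sum_univ_four, Matrix.cons_val]
  constructor
  · rintro ⟨g, e⟩
    exact ⟨_, _, _, _, e⟩
  · rintro ⟨p, q, r, s, e⟩
    exact ⟨![p, q, r, s], e⟩

/-- Here `1`, `z`, `q` are denominators of `y`, `y'` and `y + y'`. Without a common denominator, `1,
y, z, y'z` are so independent that no `q` can exist: multiplication by `y + y'` moves their span off
itself. -/
theorem Minimal₄.exists_common_of_one_mem (h : ExponentOne k L) {A : Submodule k L}
    [FiniteDimensional k A] (hd : finrank k A ≤ 5) (hA : Minimal₄ A)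
    (hA5 : finrank k A = 5 → Minimal₅ A) {y y' z q : L}
    (hy : y ∉ (⊥ : IntermediateField k L)) (hy' : y' ∉ k⟮y⟯) (h1 : (1 : L) ∈ A) (hyA : y ∈ A)
    (hz0 : z ≠ 0) (hz : z ∈ A) (hyz : y' * z ∈ A) (hq0 : q ≠ 0) (hq : q ∈ A)
    (hxq : (y + y') * q ∈ A) : ∃ v : L, v ≠ 0 ∧ v ∈ A ∧ y * v ∈ A ∧ y' * v ∈ A := by
  by_contra hno
  push Not at hno
  have hy'0 : y' ∉ (⊥ : IntermediateField k L) := fun h0 => hy' ((bot_le : ⊥ ≤ k⟮y⟯) h0)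
  have hind : LinearIndependent k ![1, y, z, y' * z] := by
    refine linearIndependent_four (by simpa using pair_indep hy one_ne_zero)
      (pair_indep hy'0 hz0) ?_
    intro s t s' t' e
    by_contra hne
    -- A nonzero `v = s + ty = s'z + t'y'z` would be a common denominator: the first form gives `yv
    -- ∈ A`, the second `y'v ∈ A`, since `y²` and `y'²` are scalars.
    refine hno _ hne (add_mem (A.smul_mem s h1) (A.smul_mem t hyA)) ?_ ?_
    · have : y * (s • 1 + t • y) = s • y + t • (y ^ 2 * 1) := by
        simp only [Algebra.smul_def]
        ring
      rw [this]
      exact add_mem (A.smul_mem s hyA) (A.smul_mem t (mul_mem_of_mem_bot (h y) h1))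
    · have : y' * (s • 1 + t • y) = s' • (y' * z) + t' • (y' ^ 2 * z) := by
        rw [e]
        simp only [Algebra.smul_def]
        ring
      rw [this]
      exact add_mem (A.smul_mem s' hyz) (A.smul_mem t' (mul_mem_of_mem_bot (h y') hz))
  have hfield : ∀ a b : L, y + y' ∈ adj₂ k a b → y' ∈ adj₂ k a b → z ∈ adj₂ k a b → False := by
    intro a b hxm hym hzm
    refine hA 1 y z (y' * z) h1 hyA hz hyz hind 1 a b one_ne_zero ?_
    rw [scale_one]
    refine ⟨one_mem (adj₂ k a b), ?_, hzm, (adj₂ k a b).mul_mem hym hzm⟩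
    have := sub_mem hxm hym
    simpa using this
  have hx0 : y + y' ∉ (⊥ : IntermediateField k L) := by
    intro h0
    apply hy'
    have := sub_mem ((bot_le : ⊥ ≤ k⟮y⟯) h0) (mem_adjoin_simple_self k y)
    simpa using this
  have hy'x : y' ∉ k⟮y + y'⟯ := fun hm =>
    hfield (y + y') z (left_mem_adj₂ _ _) (mem_sup_adjoin_of_mem hm z) (right_mem_adj₂ _ _)
  have hzx : z ∉ adj₂ k (y + y') y' := fun hm =>
    hfield (y + y') y' (left_mem_adj₂ _ _) (right_mem_adj₂ _ _) hm
  have hmemx : ∀ s t : k, algebraMap k L s + algebraMap k L t * (y + y') ∈ k⟮y + y'⟯ :=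
    fun s t => h.mem_adjoin.2 ⟨s, t, rfl⟩
  have hzero : ∀ s t : k, algebraMap k L s + algebraMap k L t * (y + y') = 0 → t = 0 := by
    intro s t e
    have := (eq_zero_of_add_mul_eq_zero hx0 (mem_bot.2 ⟨s, rfl⟩) (mem_bot.2 ⟨t, rfl⟩) e).2
    simpa using this
  set U := Submodule.span k (Set.range ![1, y, z, y' * z]) with hU
  have hUA : U ≤ A := by
    rw [hU, Submodule.span_le]
    rintro _ ⟨i, rfl⟩
    fin_cases i
    exacts [h1, hyA, hz, hyz]
  have hUrank : finrank k U = 4 := finrank_span_four hind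
  -- Comparing `xq` with its expansion over `1, y, z, y'z`, which are independent over `k(x)`, gives
  -- `qᵢx - pᵢ = 0`, hence `qᵢ = 0`.
  have stageA : ∀ q : L, q ∈ U → (y + y') * q ∈ U → q = 0 := by
    intro q hq hp
    obtain ⟨q₀, q₁, q₂, q₃, eq⟩ := mem_span_four.1 hq
    obtain ⟨p₀, p₁, p₂, p₃, ep⟩ := mem_span_four.1 hp
    rw [← eq] at ep
    simp only [Algebra.smul_def, mul_one] at ep
    have := coeff_eq_zero hy'x hzx (hmemx (-p₀) q₀) (hmemx (-p₁) q₁) (hmemx (-p₂) q₂)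
      (hmemx (-p₃) q₃) (by simp only [map_neg]; linear_combination (-1 : L) * ep)
    obtain ⟨e0, e1, e2, e3⟩ := this
    rw [← eq, hzero _ _ e0, hzero _ _ e1, hzero _ _ e2, hzero _ _ e3]
    simp
  by_cases hall : A ≤ U
  · exact hq0 (stageA q (hall hq) (hall hxq))
  · obtain ⟨e, he, heU⟩ := SetLike.not_le_iff_exists.1 hall
    have hlt : finrank k U < finrank k A :=
      Submodule.finrank_lt_finrank_of_lt
        (lt_of_le_of_ne hUA (fun h0 => heU (h0 ▸ he)))
    have hUN : ∀ u ∈ U, u ∈ adj₃ k (y + y') y' z := by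
      have hle : U ≤ toSub (adj₃ k (y + y') y' z) := by
        have hy'N : y' ∈ adj₃ k (y + y') y' z := mem_sup_adjoin_of_mem (right_mem_adj₂ _ _) z
        have hzN : z ∈ adj₃ k (y + y') y' z := mem_sup_adjoin_self _ z
        have hxN : y + y' ∈ adj₃ k (y + y') y' z := mem_sup_adjoin_of_mem (left_mem_adj₂ _ _) z
        rw [hU, Submodule.span_le]
        rintro _ ⟨i, rfl⟩
        fin_cases i
        · exact one_mem (adj₃ k (y + y') y' z)
        · have := sub_mem hxN hy'N
          simpa using this
        · exact hzN
        · exact (adj₃ k (y + y') y' z).mul_mem hy'N hzN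
      exact fun u hu => hle hu
    have hdec : ∀ a ∈ A, ∃ u ∈ U, ∃ t : k, u + t • e = a :=
      fun a ha => exists_add_smul hUA (by omega) he heU ha
    have heN : e ∉ adj₃ k (y + y') y' z := by
      intro heN
      refine hA5 (by omega) 1 (y + y') y' z one_ne_zero ?_
      rw [scale_one]
      intro a ha
      obtain ⟨u, hu, t, rfl⟩ := hdec a ha
      exact add_mem (hUN u hu) (IntermediateField.smul_mem _ heN)
    obtain ⟨q', hq', t, rfl⟩ := hdec q hq
    obtain ⟨p', hp', s, ep⟩ := hdec _ hxq
    have hxN : y + y' ∈ adj₃ k (y + y') y' z := mem_sup_adjoin_of_mem (left_mem_adj₂ _ _) z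
    -- With `q = q' + te` and `xq = p' + se`, the coefficient `s - tx` of `e` over `k(x, y', z)`
    -- must vanish; hence `s = t = 0`, and `stageA` applies.
    have e1 := (eq_zero_of_add_mul_eq_zero heN
      (m := p' - (y + y') * q') (n := algebraMap k L s + algebraMap k L (-t) * (y + y'))
      (sub_mem (hUN _ hp') (mul_mem hxN (hUN _ hq')))
      (mem_sup_adjoin_of_mem (mem_sup_adjoin_of_mem (hmemx _ _) _) _)
      (by simp only [Algebra.smul_def] at ep; simp only [map_neg]; linear_combination ep)).2
    have ht : t = 0 := by simpa using hzero _ _ e1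
    subst ht
    have hs : s = 0 := by simpa using e1
    subst hs
    simp only [zero_smul, add_zero] at ep hq0
    exact hq0 (stageA q' hq' (ep ▸ hp'))

theorem Minimal₄.exists_common (h : ExponentOne k L) {A : Submodule k L}
    [FiniteDimensional k A] (hd : finrank k A ≤ 5) (hA : Minimal₄ A)
    (hA5 : finrank k A = 5 → Minimal₅ A) {y y' u z q : L}
    (hy : y ∉ (⊥ : IntermediateField k L)) (hy' : y' ∉ k⟮y⟯) (hu0 : u ≠ 0) (hu : u ∈ A)
    (hyu : y * u ∈ A) (hz0 : z ≠ 0) (hz : z ∈ A) (hyz : y' * z ∈ A) (hq0 : q ≠ 0) (hq : q ∈ A)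
    (hxq : (y + y') * q ∈ A) : ∃ v : L, v ≠ 0 ∧ v ∈ A ∧ y * v ∈ A ∧ y' * v ∈ A := by
  have hui := inv_ne_zero hu0
  have hmem : ∀ x : L, x ∈ scale u⁻¹ A ↔ u * x ∈ A := fun x => by rw [mem_scale hui, inv_inv]
  have key : ∀ {a x : L}, a * x ∈ A → a * (u⁻¹ * x) ∈ scale u⁻¹ A := by
    intro a x hax
    rw [mul_left_comm]
    exact mul_mem_scale hax
  obtain ⟨v, hv0, hv, hyv, hyv'⟩ := Minimal₄.exists_common_of_one_mem h
    (A := scale u⁻¹ A) ((finrank_scale hui A).trans_le hd) (hA.scaled hui)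
    (fun h5 => (hA5 ((finrank_scale hui A).symm.trans h5)).scaled hui) hy hy'
    (one_mem_scale_inv hu0 hu) ((hmem y).2 (by rwa [mul_comm]))
    (mul_ne_zero hui hz0) (mul_mem_scale hz) (key hyz) (mul_ne_zero hui hq0) (mul_mem_scale hq)
    (key hxq)
  rw [hmem] at hv hyv hyv'
  exact ⟨u * v, mul_ne_zero hu0 hv0, hv, by rwa [mul_left_comm], by rwa [mul_left_comm]⟩

/-- Subspaces of the same type as a minimal subspace of dimension four or five are multiples
of it. -/
theorem SameType.proportional_of_minimal (h : ExponentOne k L) {A B : Submodule k L}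
    [FiniteDimensional k A] [FiniteDimensional k B] (hAB : SameType A B) (h3 : 3 ≤ finrank k A)
    (hd : finrank k A ≤ 5) (hA : Minimal₄ A) (hA5 : finrank k A = 5 → Minimal₅ A)
    (hnot : ∀ t x y : L, t ≠ 0 → ¬ A ≤ scale t (toSub (adj₂ k x y)))
    (hB1 : (1 : L) ∈ B) : Proportional A B := by
  have hratio : ∀ y ∈ B, ∃ u : L, u ≠ 0 ∧ u ∈ A ∧ y * u ∈ A := fun y hy =>
    hAB.exists_ratio one_ne_zero hB1 (by rwa [mul_one])
  have common : ∀ y ∈ B, ∀ y' ∈ B, y ∉ (⊥ : IntermediateField k L) → y' ∉ k⟮y⟯ →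
      ∃ v : L, v ≠ 0 ∧ v ∈ A ∧ y * v ∈ A ∧ y' * v ∈ A := by
    intro y hy y' hy' hy0 hyy'
    obtain ⟨u, hu0, hu, hyu⟩ := hratio y hy
    obtain ⟨z, hz0, hz, hyz⟩ := hratio y' hy'
    obtain ⟨q, hq0, hq, hyq⟩ := hratio (y + y') (add_mem hy hy')
    exact hA.exists_common h hd hA5 hy0 hyy' hu0 hu hyu hz0 hz hyz hq0 hq hyq
  have bound : ∀ M : IntermediateField k L, FiniteDimensional k M → finrank k M < 3 →
      ∃ y ∈ B, y ∉ M := by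
    intro M hM hlt
    by_contra! hle
    have := Submodule.finrank_mono (show B ≤ toSub M from hle)
    rw [finrank_toSub, ← hAB.1] at this
    omega
  obtain ⟨y₁, hy₁, hy₁0⟩ := bound ⊥ inferInstance (by simp)
  have hfd : FiniteDimensional k k⟮y₁⟯ := by
    have := h.finiteDimensional_sup_adjoin ⊥ y₁
    rwa [bot_sup_eq] at this
  have hrk : finrank k k⟮y₁⟯ = 2 := by
    have := h.finrank_sup_adjoin ⊥ hy₁0
    rw [bot_sup_eq] at this
    simpa using this
  obtain ⟨y₂, hy₂, hy₂1⟩ := bound k⟮y₁⟯ hfd (by omega)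
  have hy₂0 : y₂ ∉ (⊥ : IntermediateField k L) := fun h0 => hy₂1 ((bot_le : ⊥ ≤ k⟮y₁⟯) h0)
  obtain ⟨v, hv0, hv, hyv₁, hyv₂⟩ := common y₁ hy₁ y₂ hy₂ hy₁0 hy₂1
  have hvi := inv_ne_zero hv0
  -- For `y` outside `k(y₁, y₂)`, take a common denominator `p` with `y₁` and `q` with `y₂`. Then
  -- `q/p ∈ k(y) ∩ k(y₁, y₂) = k`, so `p/v ∈ k(y₁) ∩ k(y₂) = k`, and `v` itself is a denominator of
  -- `y`.
  have hsplit : ∀ y ∈ B, y ∈ scale v⁻¹ A ∨ y ∈ toSub (adj₂ k y₁ y₂) := by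
    intro y hy
    by_cases hyM : y ∈ adj₂ k y₁ y₂
    · exact Or.inr hyM
    left
    have hy1 : y ∉ k⟮y₁⟯ := fun hm => hyM (mem_sup_adjoin_of_mem hm _)
    have hy2 : y ∉ k⟮y₂⟯ := fun hm => hyM ((le_sup_right : k⟮y₂⟯ ≤ _) hm)
    have hy0 : y ∉ (⊥ : IntermediateField k L) := fun h0 => hy1 ((bot_le : ⊥ ≤ k⟮y₁⟯) h0)
    obtain ⟨p, hp0, hp, hyp1, hyp⟩ := common y₁ hy₁ y hy hy₁0 hy1
    obtain ⟨q, hq0, hq, hyq2, hyq⟩ := common y₂ hy₂ y hy hy₂0 hy2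
    have hpm : p / v ∈ k⟮y₁⟯ := hA.div_mem h hv0 hv hyv₁ hp hyp1 hy₁0
    have hqm : q / v ∈ k⟮y₂⟯ := hA.div_mem h hv0 hv hyv₂ hq hyq2 hy₂0
    have hqp : q / p ∈ k⟮y⟯ := hA.div_mem h hp0 hp hyp hq hyq hy0
    have hpM : p / v ∈ adj₂ k y₁ y₂ := mem_sup_adjoin_of_mem hpm _
    have hqM : q / v ∈ adj₂ k y₁ y₂ := (le_sup_right : k⟮y₂⟯ ≤ _) hqm
    have hqpM : q / p ∈ adj₂ k y₁ y₂ := by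
      have : q / p = (q / v) / (p / v) := by field_simp
      rw [this]
      exact div_mem hqM hpM
    obtain ⟨m, n, e⟩ := h.mem_adjoin.1 hqp
    have hn : n = 0 := by
      by_contra hn
      apply hyM
      have hn' : algebraMap k L n ≠ 0 := by simpa using hn
      have : y = (q / p - algebraMap k L m) / algebraMap k L n := by
        rw [← e]
        field_simp
        ring
      rw [this]
      exact div_mem (sub_mem hqpM (_root_.algebraMap_mem _ _)) (_root_.algebraMap_mem _ _)
    subst hn
    simp only [map_zero, zero_mul, add_zero] at e
    have hm : algebraMap k L m ≠ 0 := by rw [e]; exact div_ne_zero hq0 hp0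
    have hpm2 : p / v ∈ k⟮y₂⟯ := by
      have : p / v = (q / v) / algebraMap k L m := by rw [e]; field_simp
      rw [this]
      exact div_mem hqm (_root_.algebraMap_mem _ _)
    obtain ⟨m', n', e'⟩ := h.mem_adjoin.1 hpm2
    have hn' : n' = 0 := by
      by_contra hn'
      apply hy₂1
      have hn0 : algebraMap k L n' ≠ 0 := by simpa using hn'
      have : y₂ = (p / v - algebraMap k L m') / algebraMap k L n' := by
        rw [← e']
        field_simp
        ring
      rw [this]
      exact div_mem (sub_mem hpm (_root_.algebraMap_mem _ _)) (_root_.algebraMap_mem _ _)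
    subst hn'
    simp only [map_zero, zero_mul, add_zero] at e'
    rw [mem_scale hvi, inv_inv]
    have hvp : v / p ∈ (⊥ : IntermediateField k L) := by
      rw [← inv_div, ← e']
      exact inv_mem (_root_.algebraMap_mem _ _)
    have := mul_mem_of_mem_bot hvp hyp
    have e2 : v / p * (y * p) = v * y := by field_simp
    rwa [e2] at this
  -- A vector space is not the union of two proper subspaces.
  have hunion : B ≤ scale v⁻¹ A ∨ B ≤ toSub (adj₂ k y₁ y₂) := by
    by_contra! hno
    obtain ⟨⟨b, hb, hbA⟩, ⟨c, hc, hcM⟩⟩ :=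
      And.intro (SetLike.not_le_iff_exists.1 hno.1) (SetLike.not_le_iff_exists.1 hno.2)
    have hbM := (hsplit b hb).resolve_left hbA
    have hcA := (hsplit c hc).resolve_right hcM
    rcases hsplit (b + c) (add_mem hb hc) with h0 | h0
    · exact hbA (by simpa using sub_mem h0 hcA)
    · exact hcM (by simpa using sub_mem h0 hbM)
  rcases hunion with hle | hle
  · have := Submodule.eq_of_le_of_finrank_eq hle (by rw [finrank_scale hvi, hAB.1])
    exact ⟨v, hv0, by rw [this, scale_scale, mul_inv_cancel₀ hv0, scale_one]⟩
  · exfalso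
    have h1 := (hAB.symm.trans (sameType_scale hvi A).symm).le_toSub
      (one_mem_scale_inv hv0 hv) hle
    refine hnot v y₁ y₂ hv0 ?_
    have := scale_mono v h1
    rwa [scale_scale, mul_inv_cancel₀ hv0, scale_one] at this

end Minimal

/-! ### Subspaces of dimension at most five. -/

section Classification

variable {k L : Type*} [Field k] [Field L] [Algebra k L]

theorem ExponentOne.adj₂_finrank (h : ExponentOne k L) (x y : L) :
    FiniteDimensional k (adj₂ k x y) ∧ (finrank k (adj₂ k x y) = 1 ∨ finrank k (adj₂ k x y) = 2 ∨
      finrank k (adj₂ k x y) = 4) := by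
  have step : ∀ (M : IntermediateField k L) [FiniteDimensional k M] (a : L),
      finrank k ↥(M ⊔ k⟮a⟯) = finrank k M ∨ finrank k ↥(M ⊔ k⟮a⟯) = 2 * finrank k M := by
    intro M _ a
    by_cases ha : a ∈ M
    · rw [sup_adjoin_eq_self ha]
      exact Or.inl rfl
    · exact Or.inr (h.finrank_sup_adjoin M ha)
  have hx : FiniteDimensional k k⟮x⟯ := by
    have := h.finiteDimensional_sup_adjoin ⊥ x
    rwa [bot_sup_eq] at this
  have hx1 := step ⊥ x
  rw [bot_sup_eq, IntermediateField.finrank_bot] at hx1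
  have hxy := step k⟮x⟯ y
  refine ⟨h.finiteDimensional_sup_adjoin _ y, ?_⟩
  rw [adj₂]
  omega

theorem ExponentOne.adj₃_finrank (h : ExponentOne k L) (x y z : L) :
    FiniteDimensional k (adj₃ k x y z) ∧ (finrank k (adj₃ k x y z) ≤ 4 ∨
      finrank k (adj₃ k x y z) = 8) := by
  obtain ⟨hf, hr⟩ := h.adj₂_finrank x y
  refine ⟨h.finiteDimensional_sup_adjoin _ z, ?_⟩
  rw [adj₃]
  by_cases hz : z ∈ adj₂ k x y
  · rw [sup_adjoin_eq_self hz]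
    omega
  · rw [h.finrank_sup_adjoin _ hz]
    omega

/-- Every linear functional on a finite extension is a multiple of a given nonzero one. -/
theorem exists_eq_comp_mulLeft [FiniteDimensional k L] {s : Dual k L} (hs : s ≠ 0)
    (t : Dual k L) : ∃ c : L, ∀ x, t x = s (c * x) := by
  -- `c ↦ s(c ·)` is injective because `L` is a field, hence bijective by dimension.
  let T : L →ₗ[k] Dual k L := (LinearMap.mul k L).compr₂ s
  have hT : ∀ c x, T c x = s (c * x) := fun c x => rfl
  have hinj : Function.Injective T := by
    rw [← LinearMap.ker_eq_bot, LinearMap.ker_eq_bot']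
    intro c hc
    by_contra h0
    apply hs
    ext x
    have := hT c (c⁻¹ * x)
    rw [hc, mul_inv_cancel_left₀ h0] at this
    simpa using this.symm
  have hsurj := (LinearMap.injective_iff_surjective_of_finrank_eq_finrank
    (Subspace.dual_finrank_eq (K := k) (V := L)).symm).1 hinj
  obtain ⟨c, rfl⟩ := hsurj t
  exact ⟨c, hT c⟩

/-- Hyperplanes in a finite extension are proportional. -/
theorem proportional_of_hyperplane [FiniteDimensional k L] {A B : Submodule k L}
    (hA : finrank k A + 1 = finrank k L) (hB : finrank k B + 1 = finrank k L) :
    Proportional A B := by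
  have hyp : ∀ C : Submodule k L, finrank k C + 1 = finrank k L →
      ∃ s : Dual k L, s ≠ 0 ∧ ∀ x, x ∈ C ↔ s x = 0 := by
    intro C hC
    have hlt : C < ⊤ := lt_top_iff_ne_top.2 fun h0 => by
      rw [h0, finrank_top] at hC
      omega
    obtain ⟨s, hs, hle⟩ := C.exists_le_ker_of_lt_top hlt
    refine ⟨s, hs, fun x => ?_⟩
    rw [← LinearMap.mem_ker]
    have h1 : finrank k (LinearMap.ker s) < finrank k L :=
      Submodule.finrank_lt (fun h0 => hs (LinearMap.ker_eq_top.1 h0))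
    rw [Submodule.eq_of_le_of_finrank_le hle (by omega)]
  obtain ⟨s, hs, hsA⟩ := hyp A hA
  obtain ⟨t, ht, htB⟩ := hyp B hB
  obtain ⟨c, hc⟩ := exists_eq_comp_mulLeft hs t
  have hc0 : c ≠ 0 := by
    rintro rfl
    exact ht (by ext x; simp [hc])
  refine ⟨c, hc0, ?_⟩
  ext x
  rw [mem_scale hc0, htB, hc, mul_inv_cancel_left₀ hc0, hsA]

/-- A subspace of codimension three in an extension of degree eight contains a multiple of a
subfield of degree four. -/
theorem ExponentOne.exists_scale_le (h : ExponentOne k L) [FiniteDimensional k L]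
    (hL : finrank k L = 8) {A : Submodule k L} (hA : finrank k A = 5) :
    ∃ w : L, w ≠ 0 ∧ ∃ M : IntermediateField k L, finrank k M = 4 ∧ scale w (toSub M) ≤ A := by
  have hQ : finrank k (L ⧸ A) = 3 := by
    have := Submodule.finrank_quotient_add_finrank A
    omega
  let b := finBasisOfFinrankEq k (L ⧸ A) hQ
  -- Three independent functionals cut out `A`; write them as `s₀`, `s₀(c ·)`, `s₀(d ·)`.
  -- Independence makes `k(c, d)` of degree 4.
  let s : Fin 3 → Dual k L := fun i => b.coord i ∘ₗ A.mkQ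
  have hsA : ∀ x, (∀ i, s i x = 0) → x ∈ A := by
    intro x hx
    rw [← Submodule.Quotient.mk_eq_zero]
    exact b.ext_elem fun i => by simpa [s] using hx i
  have hdual : ∀ i, ∃ x, ∀ j, s j x = if i = j then 1 else 0 := by
    intro i
    obtain ⟨x, hx⟩ := A.mkQ_surjective (b i)
    exact ⟨x, fun j => by simp [s, hx, Finsupp.single_apply]⟩
  have hs0 : s 0 ≠ 0 := by
    intro h0
    obtain ⟨x, hx⟩ := hdual 0
    have := hx 0
    simp [h0] at this
  obtain ⟨c, hc⟩ := exists_eq_comp_mulLeft hs0 (s 1)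
  obtain ⟨d, hd⟩ := exists_eq_comp_mulLeft hs0 (s 2)
  have hc0 : c ∉ (⊥ : IntermediateField k L) := by
    intro hm
    obtain ⟨r, rfl⟩ := mem_bot.1 hm
    obtain ⟨x, hx⟩ := hdual 1
    have := hc x
    rw [← Algebra.smul_def, map_smul, hx, hx] at this
    simp at this
  have hd0 : d ∉ k⟮c⟯ := by
    intro hm
    obtain ⟨m, n, rfl⟩ := h.mem_adjoin.1 hm
    obtain ⟨x, hx⟩ := hdual 2
    have := hd x
    rw [add_mul, mul_assoc, ← Algebra.smul_def, ← Algebra.smul_def, map_add, map_smul, map_smul,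
      ← hc, hx, hx, hx] at this
    simp at this
  have hM : finrank k (adj₂ k c d) = 4 := by
    rw [adj₂, h.finrank_sup_adjoin _ hd0]
    have := h.finrank_sup_adjoin ⊥ hc0
    rw [bot_sup_eq, IntermediateField.finrank_bot] at this
    omega
  -- A map from dimension 8 to dimension 4 has a kernel: some `w ≠ 0` has `s₀` vanishing on `w k(c,
  -- d)`. This space is stable under `c` and `d`, so all three functionals vanish on it.
  let T : L →ₗ[k] Dual k (toSub (adj₂ k c d)) :=
    ((LinearMap.mul k L).compr₂ (s 0)).compl₂ (toSub (adj₂ k c d)).subtype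
  have hker : LinearMap.ker T ≠ ⊥ := by
    apply LinearMap.ker_ne_bot_of_finrank_lt
    rw [Subspace.dual_finrank_eq, finrank_toSub]
    omega
  obtain ⟨w, hw, hw0⟩ := Submodule.exists_mem_ne_zero_of_ne_bot hker
  have hwM : ∀ m ∈ adj₂ k c d, s 0 (w * m) = 0 := by
    intro m hm
    have := LinearMap.congr_fun (LinearMap.mem_ker.1 hw) ⟨m, hm⟩
    exact this
  refine ⟨w, hw0, adj₂ k c d, hM, ?_⟩
  rintro _ ⟨m, hm, rfl⟩
  refine hsA _ fun i => ?_
  rw [LinearMap.mulLeft_apply]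
  fin_cases i
  · exact hwM m hm
  · change s 1 _ = 0
    rw [hc, mul_left_comm]
    exact hwM _ (mul_mem (left_mem_adj₂ c d) hm)
  · change s 2 _ = 0
    rw [hd, mul_left_comm]
    exact hwM _ (mul_mem (right_mem_adj₂ c d) hm)

/-- The part of a subspace inside an intermediate field. -/
def restrict (N : IntermediateField k L) (A : Submodule k L) : Submodule k N :=
  A.comap N.val.toLinearMap

theorem mem_restrict {N : IntermediateField k L} {A : Submodule k L} {x : N} :
    x ∈ restrict N A ↔ (x : L) ∈ A := Iff.rfl

theorem finrank_restrict {N : IntermediateField k L} {A : Submodule k L} (hA : A ≤ toSub N) :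
    finrank k (restrict N A) = finrank k A :=
  (Submodule.comapSubtypeEquivOfLe hA).finrank_eq

theorem ExponentOne.restrict (h : ExponentOne k L) (N : IntermediateField k L) :
    ExponentOne k N := by
  intro x
  obtain ⟨r, hr⟩ := mem_bot.1 (h x)
  exact mem_bot.2 ⟨r, Subtype.ext hr⟩

/-- Lets `proportional_of_hyperplane`, which needs a finite extension, be applied inside a finite
subextension of `L`. -/
theorem proportional_of_restrict {N : IntermediateField k L} {A B : Submodule k L}
    (hA : A ≤ toSub N) (hB : B ≤ toSub N) (h : Proportional (restrict N A) (restrict N B)) :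
    Proportional A B := by
  obtain ⟨c, hc, e⟩ := h
  have hc' : (c : L) ≠ 0 := by simpa using hc
  refine ⟨c, hc', ?_⟩
  have key : ∀ x : N, (x : L) ∈ A ↔ (x : L) ∈ scale (c : L) B := by
    intro x
    rw [← mem_restrict, e, mem_scale hc, mem_scale hc', mem_restrict]
    rfl
  ext x
  refine ⟨fun hx => (key ⟨x, hA hx⟩).1 hx, fun hx => ?_⟩
  have hxN : x ∈ N := by
    have := (mem_scale hc').1 hx
    have := N.mul_mem c.2 (hB this)
    rwa [mul_inv_cancel_left₀ hc'] at this
  exact (key ⟨x, hxN⟩).2 hx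

theorem ExponentOne.exists_scale_le_of_le (h : ExponentOne k L) {N : IntermediateField k L}
    [FiniteDimensional k N] (hN : finrank k N = 8) {A : Submodule k L} (hAN : A ≤ toSub N)
    (hA : finrank k A = 5) :
    ∃ w : L, w ≠ 0 ∧ ∃ M : IntermediateField k L, finrank k M = 4 ∧ scale w (toSub M) ≤ A := by
  obtain ⟨w, hw, M, hM, hle⟩ := (h.restrict N).exists_scale_le hN
    ((finrank_restrict hAN).trans hA)
  have hw' : (w : L) ≠ 0 := by simpa using hw
  refine ⟨w, hw', IntermediateField.lift M, ?_, ?_⟩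
  · rw [← hM]
    exact (IntermediateField.liftAlgEquiv M).toLinearEquiv.finrank_eq.symm
  · intro x hx
    rw [mem_scale hw', mem_toSub] at hx
    obtain ⟨y, hy, e⟩ := hx
    have e1 : x = ((w * y : N) : L) := by
      rw [MulMemClass.coe_mul]
      change (y : L) = _ at e
      rw [e, mul_inv_cancel_left₀ hw']
    rw [e1]
    exact hle (mul_mem_scale_toSub w hy)

/-- Subspaces of the same type which are hyperplanes over subfields of degree four are
proportional. -/
theorem SameType.proportional_of_field_le (h : ExponentOne k L) {A B : Submodule k L}
    [FiniteDimensional k A] [FiniteDimensional k B] (hAB : SameType A B)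
    (hA : finrank k A = 5) {M M' : IntermediateField k L} (hM : finrank k M = 4)
    (hM' : finrank k M' = 4) (hMA : toSub M ≤ A) (hMB : toSub M' ≤ B) : Proportional A B := by
  have hB : finrank k B = 5 := hAB.1.symm.trans hA
  have hfM' : FiniteDimensional k M' := FiniteDimensional.of_finrank_pos (by omega)
  have hle : M ≤ M' := by
    intro x hx
    have h4 : 4 ≤ finrank k (selfInter x B) := by
      rw [← hAB.2 x, ← hM, ← finrank_toSub]
      exact Submodule.finrank_mono fun m hm => ⟨hMA hm, hMA (M.mul_mem hx hm)⟩
    rcases eq_or_ne x 0 with rfl | hx0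
    · exact M'.zero_mem
    have hcodim : ∀ (S T : Submodule k L), S ≤ B → T ≤ B →
        finrank k S + finrank k T ≤ finrank k ↥(S ⊓ T) + 5 := by
      intro S T hS hT
      have := Submodule.finiteDimensional_of_le hS
      have := Submodule.finiteDimensional_of_le hT
      have h1 := Submodule.finrank_sup_add_finrank_inf_eq S T
      have h2 := Submodule.finrank_mono (sup_le hS hT)
      omega
    -- Inside the 5-dimensional `B`, the space `S = selfInter x B ∩ M'` has dimension at least `4 +
    -- 4 - 5 = 3`, so `xS ∩ M'` has dimension at least `3 + 4 - 5 = 2`. A nonzero vector there shows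
    -- that `x` is a quotient of elements of `M'`.
    have h1 := hcodim (selfInter x B) (toSub M') (selfInter_le x B) hMB
    have h2 := hcodim (scale x (selfInter x B ⊓ toSub M')) (toSub M')
      (by rintro _ ⟨v, hv, rfl⟩; exact hv.1.2) hMB
    rw [finrank_scale hx0] at h2
    rw [finrank_toSub, hM'] at h1 h2
    have h3 : scale x (selfInter x B ⊓ toSub M') ⊓ toSub M' ≠ ⊥ := by
      intro h0
      rw [h0, finrank_bot] at h2
      omega
    obtain ⟨v, hv, hv0⟩ := Submodule.exists_mem_ne_zero_of_ne_bot h3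
    have hv1 : x⁻¹ * v ∈ M' := ((mem_scale hx0).1 hv.1).2
    have e : x = v / (x⁻¹ * v) := by field_simp
    rw [e]
    exact M'.div_mem hv.2 hv1
  have hMM : M = M' := IntermediateField.eq_of_le_of_finrank_eq hle (hM.trans hM'.symm)
  subst hMM
  have hlt : ∀ C : Submodule k L, finrank k C = 5 → ∃ d ∈ C, d ∉ M := by
    intro C hC
    by_contra! hno
    have := Submodule.finrank_mono (show C ≤ toSub M from hno)
    rw [finrank_toSub] at this
    omega
  obtain ⟨d, hdA, hd⟩ := hlt A hA
  obtain ⟨d', hdB, hd'⟩ := hlt B hB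
  have hAd : ∀ a ∈ A, ∃ m ∈ M, ∃ t : k, m + t • d = a := fun a ha =>
    exists_add_smul hMA (by rw [finrank_toSub]; omega) hdA hd ha
  have hAN : A ≤ toSub (M ⊔ k⟮d⟯) := by
    intro a ha
    obtain ⟨m, hm, t, rfl⟩ := hAd a ha
    exact add_mem (mem_sup_adjoin_of_mem hm d)
      (IntermediateField.smul_mem _ (mem_sup_adjoin_self M d))
  have hBN := hAB.le_toSub (hMB M.one_mem) hAN
  -- As `A = M + kd`, `B = M + kd'` and `d' = m + nd` with `m, n ∈ M`, multiplication by `n` carries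
  -- `A` onto `B`.
  obtain ⟨m, hm, n, hn, e⟩ := h.mem_sup_adjoin.1 (hBN hdB)
  have hn0 : n ≠ 0 := by
    rintro rfl
    exact hd' (by rw [← e]; simpa using hm)
  have hsc : scale n A ≤ B := by
    rintro _ ⟨a, ha, rfl⟩
    obtain ⟨m', hm', t, rfl⟩ := hAd a ha
    have e2 : n * (m' + t • d) = (n * m' - t • m) + t • d' := by
      rw [← e]
      simp only [Algebra.smul_def]
      ring
    rw [LinearMap.mulLeft_apply, e2]
    exact add_mem (hMB (M.sub_mem (M.mul_mem hn hm') (IntermediateField.smul_mem _ hm)))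
      (B.smul_mem t hdB)
  refine Proportional.symm ⟨n, hn0, ?_⟩
  exact (Submodule.eq_of_le_of_finrank_eq hsc (by rw [finrank_scale hn0, hA, hB])).symm

theorem scale_inv_le {A B : Submodule k L} {t : L} (ht : t ≠ 0) (h : A ≤ scale t B) :
    scale t⁻¹ A ≤ B := by
  have := scale_mono t⁻¹ h
  rwa [scale_scale, inv_mul_cancel₀ ht, scale_one] at this

theorem SameType.proportional_of_one_mem (h : ExponentOne k L) {A B : Submodule k L}
    [FiniteDimensional k A] [FiniteDimensional k B] (hAB : SameType A B)
    (hd : finrank k A ≤ 5) (hA1 : (1 : L) ∈ A) (hB1 : (1 : L) ∈ B) : Proportional A B := by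
  have hbot : toSub (⊥ : IntermediateField k L) ≤ A := fun c hc => by
    simpa using mul_mem_of_mem_bot hc hA1
  by_cases hA0 : A ≤ toSub ⊥
  · exact hAB.proportional_of_eq_toSub hB1 (le_antisymm hA0 hbot)
  obtain ⟨a, ha, ha0⟩ := SetLike.not_le_iff_exists.1 hA0
  have hka : toSub k⟮a⟯ ≤ A := by
    intro x hx
    obtain ⟨m, n, rfl⟩ := h.mem_adjoin.1 hx
    rw [← Algebra.smul_def]
    exact add_mem (hbot (mem_bot.2 ⟨m, rfl⟩)) (A.smul_mem n ha)
  by_cases hA2 : A ≤ toSub k⟮a⟯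
  · exact hAB.proportional_of_eq_toSub hB1 (le_antisymm hA2 hka)
  obtain ⟨b, hb, hb0⟩ := SetLike.not_le_iff_exists.1 hA2
  have hka2 : finrank k (toSub k⟮a⟯) = 2 := by
    have := h.finrank_sup_adjoin ⊥ ha0
    rw [bot_sup_eq, IntermediateField.finrank_bot] at this
    rw [finrank_toSub, this]
  have h3 : 3 ≤ finrank k A := by
    have := Submodule.finrank_lt_finrank_of_lt (lt_of_le_not_ge hka hA2)
    omega
  by_cases hnot : ∀ t x y : L, t ≠ 0 → ¬ A ≤ scale t (toSub (adj₂ k x y))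
  · have h4 : 4 ≤ finrank k A := by
      by_contra hlt
      apply hnot 1 a b one_ne_zero
      rw [scale_one]
      intro x hx
      obtain ⟨u, hu, t, rfl⟩ := exists_add_smul hka (by omega) hb hb0 hx
      exact add_mem (mem_sup_adjoin_of_mem hu b)
        (IntermediateField.smul_mem _ (right_mem_adj₂ a b))
    have hspan : ∀ (C : Submodule k L) (p q r s : L), (p ∈ C ∧ q ∈ C ∧ r ∈ C ∧ s ∈ C) →
        Submodule.span k (Set.range ![p, q, r, s]) ≤ C := by
      rintro C p q r s ⟨hp, hq, hr, hs⟩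
      rw [Submodule.span_le]
      rintro _ ⟨i, rfl⟩
      fin_cases i <;> assumption
    by_cases h5 : finrank k A = 5 → Minimal₅ A
    · refine hAB.proportional_of_minimal h h3 hd ?_ h5 hnot hB1
      intro p q r s hp hq hr hs hi t x y ht hmem
      have hUA := hspan A p q r s ⟨hp, hq, hr, hs⟩
      have hUM := hspan _ p q r s hmem
      have hU := finrank_span_four hi
      by_cases hall : A ≤ Submodule.span k (Set.range ![p, q, r, s])
      · exact hnot t x y ht (hall.trans hUM)
      have hlt := Submodule.finrank_lt_finrank_of_lt (lt_of_le_not_ge hUA hall)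
      obtain ⟨e, he, heU⟩ := SetLike.not_le_iff_exists.1 hall
      -- If four independent vectors lie in `t k(x, y)`, one further generator absorbs the fifth
      -- dimension, contradicting `Minimal₅`.
      refine h5 (by omega) t x y (t⁻¹ * e) ht ?_
      intro v hv
      obtain ⟨u, hu, c, rfl⟩ := exists_add_smul hUA (by omega) he heU hv
      refine add_mem ?_ (Submodule.smul_mem _ c ?_)
      · exact scale_mono t (fun z hz => mem_sup_adjoin_of_mem hz _) (hUM hu)
      · rw [mem_scale ht]
        exact mem_sup_adjoin_self _ _
    · rw [Classical.not_imp] at h5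
      obtain ⟨h5, hmin⟩ := h5
      simp only [Minimal₅, not_forall, not_not] at hmin
      obtain ⟨t, x, y, z, ht, hle⟩ := hmin
      have hti := inv_ne_zero ht
      have hle' := scale_inv_le ht hle
      obtain ⟨hf, hr⟩ := h.adj₃_finrank x y z
      have h5' : finrank k (scale t⁻¹ A) = 5 := (finrank_scale hti A).trans h5
      have hN : finrank k (adj₃ k x y z) = 8 := by
        have := Submodule.finrank_mono hle'
        rw [finrank_toSub] at this
        omega
      have hAB' : SameType (scale t⁻¹ A) B := (sameType_scale hti A).trans hAB
      have hBN := hAB'.le_toSub hB1 hle'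
      obtain ⟨w, hw, M, hM, hwM⟩ := h.exists_scale_le_of_le hN hle' h5'
      obtain ⟨w', hw', M', hM', hwM'⟩ := h.exists_scale_le_of_le hN hBN (hAB'.1.symm.trans h5')
      have inv_scale : ∀ {w : L} {M C : Submodule k L}, w ≠ 0 → scale w M ≤ C →
          M ≤ scale w⁻¹ C := by
        intro w M C hw hle
        have := scale_mono w⁻¹ hle
        rwa [scale_scale, inv_mul_cancel₀ hw, scale_one] at this
      refine proportional_of_scale hti one_ne_zero ?_
      rw [scale_one]
      refine proportional_of_scale (inv_ne_zero hw) (inv_ne_zero hw') ?_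
      exact (hAB'.scale_both (inv_ne_zero hw) (inv_ne_zero hw')).proportional_of_field_le h
        ((finrank_scale (inv_ne_zero hw) _).trans h5') hM hM' (inv_scale hw hwM)
        (inv_scale hw' hwM')
  · push Not at hnot
    obtain ⟨t, x, y, ht, hle⟩ := hnot
    have hti := inv_ne_zero ht
    have hle' := scale_inv_le ht hle
    obtain ⟨hf, hr⟩ := h.adj₂_finrank x y
    have hAB' : SameType (scale t⁻¹ A) B := (sameType_scale hti A).trans hAB
    have hBN := hAB'.le_toSub hB1 hle'
    have hr' := Submodule.finrank_mono hle'
    rw [finrank_scale hti, finrank_toSub] at hr'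
    refine proportional_of_scale hti one_ne_zero ?_
    rw [scale_one]
    -- Since `3 ≤ dim A`, the field `k(x, y)` has degree 4, and `t⁻¹A` is all of it or a hyperplane.
    by_cases h4 : finrank k A = 4
    · refine hAB'.proportional_of_eq_toSub hB1 (M := adj₂ k x y) ?_
      exact Submodule.eq_of_le_of_finrank_le hle' (by rw [finrank_scale hti, finrank_toSub]; omega)
    · refine proportional_of_restrict hle' hBN (proportional_of_hyperplane ?_ ?_)
      · rw [finrank_restrict hle', finrank_scale hti]
        omega
      · rw [finrank_restrict hBN, ← hAB.1]
        omega

/-- Subspaces of dimension at most five of the same type are proportional. -/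
theorem SameType.proportional (h : ExponentOne k L) {A B : Submodule k L}
    [FiniteDimensional k A] [FiniteDimensional k B] (hAB : SameType A B)
    (hd : finrank k A ≤ 5) : Proportional A B := by
  rcases eq_or_ne A ⊥ with hA | hA
  · have hB := hAB.1
    rw [hA, finrank_bot, eq_comm, Submodule.finrank_eq_zero] at hB
    rw [hA, hB]
    exact Proportional.refl _
  · have hB : B ≠ ⊥ := by
      intro h0
      have := hAB.1
      rw [h0, finrank_bot, Submodule.finrank_eq_zero] at this
      exact hA this
    obtain ⟨a, ha, ha0⟩ := Submodule.exists_mem_ne_zero_of_ne_bot hA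
    obtain ⟨b, hb, hb0⟩ := Submodule.exists_mem_ne_zero_of_ne_bot hB
    refine proportional_of_scale (inv_ne_zero ha0) (inv_ne_zero hb0) ?_
    exact (hAB.scale_both (inv_ne_zero ha0) (inv_ne_zero hb0)).proportional_of_one_mem h
      ((finrank_scale (inv_ne_zero ha0) A).trans_le hd) (one_mem_scale_inv ha0 ha)
      (one_mem_scale_inv hb0 hb)

end Classification

/-! ### Totally singular forms as subspaces of the Frobenius extension. -/

section Forms

/-- The field `F`, regarded as an extension of `F` through the Frobenius map `a ↦ a ^ 2`. -/
def FrobeniusField (F : Type u) : Type u := F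

instance FrobeniusField.instField (F : Type u) [Field F] : Field (FrobeniusField F) :=
  inferInstanceAs (Field F)

/-- The identity map from `F` to `FrobeniusField F`. -/
def toFrobenius (F : Type u) [Field F] : F ≃+* FrobeniusField F := RingEquiv.refl F

noncomputable instance FrobeniusField.instAlgebra (F : Type u) [Field F] [CharP F 2] :
    Algebra F (FrobeniusField F) :=
  ((toFrobenius F).toRingHom.comp (frobenius F 2)).toAlgebra

variable {F : Type u} {V : Type v} {W : Type w} [Field F] [CharP F 2] [AddCommGroup V]
  [Module F V] [AddCommGroup W] [Module F W]

theorem algebraMap_frobeniusField (a : F) :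
    algebraMap F (FrobeniusField F) a = toFrobenius F (a ^ 2) := rfl

theorem exponentOne_frobeniusField : ExponentOne F (FrobeniusField F) := fun x =>
  mem_bot.2 ⟨(toFrobenius F).symm x, by rw [algebraMap_frobeniusField, map_pow,
    RingEquiv.apply_symm_apply]⟩

/-- A totally singular form as a linear map to the Frobenius extension. -/
noncomputable def IsTotallySingular.valueMap {φ : QuadraticForm F V} (hφ : IsTotallySingular φ) :
    V →ₗ[F] FrobeniusField F where
  toFun v := toFrobenius F (φ v)
  map_add' v w := by rw [hφ.map_add, _root_.map_add]
  map_smul' a v := by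
    rw [QuadraticMap.map_smul, RingHom.id_apply, smul_eq_mul,
      Algebra.smul_def a (toFrobenius F (φ v)), algebraMap_frobeniusField, ← map_mul, sq]

theorem IsTotallySingular.valueMap_apply {φ : QuadraticForm F V} (hφ : IsTotallySingular φ)
    (v : V) : hφ.valueMap v = toFrobenius F (φ v) := rfl

/-- The subspace of values of a totally singular form. -/
noncomputable def IsTotallySingular.values {φ : QuadraticForm F V} (hφ : IsTotallySingular φ) :
    Submodule F (FrobeniusField F) :=
  LinearMap.range hφ.valueMap

theorem IsTotallySingular.ker_valueMap {φ : QuadraticForm F V} (hφ : IsTotallySingular φ) :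
    LinearMap.ker hφ.valueMap = φ.radical := by
  ext v
  rw [LinearMap.mem_ker, hφ.mem_radical, hφ.valueMap_apply, map_eq_zero_iff _ (RingEquiv.injective _)]

instance IsTotallySingular.finiteDimensional_values [FiniteDimensional F V]
    {φ : QuadraticForm F V} (hφ : IsTotallySingular φ) : FiniteDimensional F hφ.values :=
  inferInstanceAs (FiniteDimensional F (LinearMap.range hφ.valueMap))

theorem IsTotallySingular.finrank_values_add_defect [FiniteDimensional F V]
    {φ : QuadraticForm F V} (hφ : IsTotallySingular φ) :
    finrank F hφ.values + defect φ = finrank F V := by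
  rw [defect, ← hφ.ker_valueMap]
  exact LinearMap.finrank_range_add_finrank_ker _

/-- Two linear maps with the same range on spaces of the same dimension differ by an
isomorphism. -/
theorem exists_linearEquiv_of_range_eq {K M : Type*} [Field K] [AddCommGroup M] [Module K M]
    {V W : Type*} [AddCommGroup V] [Module K V] [AddCommGroup W] [Module K W]
    [FiniteDimensional K V] [FiniteDimensional K W] (hd : finrank K V = finrank K W)
    (f : V →ₗ[K] M) (g : W →ₗ[K] M) (hr : LinearMap.range f = LinearMap.range g) :
    ∃ e : V ≃ₗ[K] W, ∀ v, g (e v) = f v := by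
  obtain ⟨C, hC⟩ := Submodule.exists_isCompl (LinearMap.ker f)
  obtain ⟨D, hD⟩ := Submodule.exists_isCompl (LinearMap.ker g)
  have h1 := LinearMap.finrank_range_add_finrank_ker f
  have h2 := LinearMap.finrank_range_add_finrank_ker g
  rw [← hr] at h2
  let e₁ : LinearMap.ker f ≃ₗ[K] LinearMap.ker g := LinearEquiv.ofFinrankEq _ _ (by omega)
  let e₂ : C ≃ₗ[K] D := (LinearMap.kerComplementEquivRange f hC.symm).trans
    ((LinearEquiv.ofEq _ _ hr).trans (LinearMap.kerComplementEquivRange g hD.symm).symm)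
  have he₂ : ∀ c : C, g (e₂ c) = f c := by
    intro c
    have := LinearEquiv.apply_symm_apply (LinearMap.kerComplementEquivRange g hD.symm)
      (LinearEquiv.ofEq _ _ hr (LinearMap.kerComplementEquivRange f hC.symm c))
    exact congrArg Subtype.val this
  refine ⟨(Submodule.prodEquivOfIsCompl _ _ hC).symm.trans
    ((e₁.prodCongr e₂).trans (Submodule.prodEquivOfIsCompl _ _ hD)), fun v => ?_⟩
  obtain ⟨⟨p, q⟩, rfl⟩ := (Submodule.prodEquivOfIsCompl _ _ hC).surjective v
  simp [he₂]

theorem IsTotallySingular.similar_of_proportional [FiniteDimensional F V]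
    [FiniteDimensional F W] {φ : QuadraticForm F V} {ψ : QuadraticForm F W}
    (hφ : IsTotallySingular φ) (hψ : IsTotallySingular ψ) (hd : finrank F V = finrank F W)
    (h : Proportional hφ.values hψ.values) : Similar φ ψ := by
  obtain ⟨c, hc, e⟩ := h
  obtain ⟨f, hf⟩ := exists_linearEquiv_of_range_eq hd hφ.valueMap
    (LinearMap.mulLeft F c ∘ₗ hψ.valueMap) (e.trans (LinearMap.range_comp _ _).symm)
  refine ⟨(toFrobenius F).symm c, by simpa using hc, ⟨⟨f, fun v => ?_⟩⟩⟩
  apply (toFrobenius F).injective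
  have := hf v
  rw [LinearMap.comp_apply, LinearMap.mulLeft_apply, hφ.valueMap_apply, hψ.valueMap_apply] at this
  rw [← this]
  change toFrobenius F ((toFrobenius F).symm c * ψ (f v)) = _
  rw [map_mul, RingEquiv.apply_symm_apply]

/-! ### From defects to the type of the value space. -/

theorem IsTotallySingular.defect_baseChange_self {φ : QuadraticForm F V}
    (hφ : IsTotallySingular φ) : defect (hφ.baseChange F) = defect φ := by
  have : (hφ.baseChange F).radical =
      φ.radical.map ((TensorProduct.lid F V).symm : V →ₗ[F] F ⊗[F] V) := by
    ext t
    obtain ⟨v, rfl⟩ := (TensorProduct.lid F V).symm.surjective t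
    rw [(hφ.isTotallySingular_baseChange F).mem_radical, TensorProduct.lid_symm_apply,
      hφ.baseChange_tmul F, Submodule.mem_map]
    simp only [one_pow, one_mul, Algebra.algebraMap_self, RingHom.id_apply]
    constructor
    · exact fun h => ⟨v, (hφ.mem_radical v).2 h, rfl⟩
    · rintro ⟨v', hv', e⟩
      have : v' = v := (TensorProduct.lid F V).symm.injective e
      rw [← this]
      exact (hφ.mem_radical v').1 hv'
  rw [defect, this, LinearEquiv.finrank_map_eq, defect]

theorem inf_scale_eq {k L : Type*} [Field k] [Field L] [Algebra k L] {x : L} (hx : x ≠ 0)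
    (A : Submodule k L) : A ⊓ scale x A = scale x (selfInter x A) := by
  ext v
  rw [Submodule.mem_inf, mem_scale hx, mem_scale hx, mem_selfInter, mul_inv_cancel_left₀ hx,
    and_comm]

/-- The map `(v, w) ↦ φ(v) + x φ(w)`. -/
noncomputable def IsTotallySingular.valueMap₂ {φ : QuadraticForm F V} (hφ : IsTotallySingular φ)
    (x : F) : V × V →ₗ[F] FrobeniusField F :=
  hφ.valueMap.coprod (LinearMap.mulLeft F (toFrobenius F x) ∘ₗ hφ.valueMap)

/-- The range is `A + xA`, and `A ∩ xA` is `x` times `selfInter x A`; combine rank-nullity with the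
dimension formula for sums. -/
theorem IsTotallySingular.finrank_ker_valueMap₂ [FiniteDimensional F V] {φ : QuadraticForm F V}
    (hφ : IsTotallySingular φ) {x : F} (hx : x ≠ 0) :
    finrank F (LinearMap.ker (hφ.valueMap₂ x)) + 2 * finrank F hφ.values =
      2 * finrank F V + finrank F (selfInter (toFrobenius F x) hφ.values) := by
  have hx' : toFrobenius F x ≠ 0 := by simpa using hx
  have hr : LinearMap.range (hφ.valueMap₂ x) =
      hφ.values ⊔ scale (toFrobenius F x) hφ.values := by
    rw [valueMap₂, LinearMap.range_coprod, LinearMap.range_comp]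
    rfl
  have h1 := LinearMap.finrank_range_add_finrank_ker (hφ.valueMap₂ x)
  have h2 := Submodule.finrank_sup_add_finrank_inf_eq hφ.values
    (scale (toFrobenius F x) hφ.values)
  rw [inf_scale_eq hx', finrank_scale hx', finrank_scale hx'] at h2
  rw [hr, finrank_prod] at h1
  omega

theorem finrank_mul_finrank_submodule {F E M : Type*} [Field F] [Field E] [Algebra F E]
    [AddCommGroup M] [Module E M] [Module F M] [IsScalarTower F E M] (R : Submodule E M) :
    finrank F E * finrank E R = finrank F (R.restrictScalars F) :=
  finrank_mul_finrank F E R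

/-- The defect over a quadratic extension `F(√x)`. -/
theorem IsTotallySingular.two_mul_defect_baseChange [FiniteDimensional F V]
    {φ : QuadraticForm F V} (hφ : IsTotallySingular φ) {E : Type*} [Field E] [Algebra F E]
    (hE : finrank F E = 2) {x : F} {s : E} (hs : s ^ 2 = algebraMap F E x)
    (hspan : ∀ e : E, ∃ a b : F, e = a • 1 + b • s) :
    2 * defect (hφ.baseChange E) = finrank F (LinearMap.ker (hφ.valueMap₂ x)) := by
  -- Each element of `E ⊗ V` is uniquely `1 ⊗ v + s ⊗ w`, and there `φ_E` takes the value `φ(v) +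
  -- xφ(w)`. So the radical of `φ_E`, viewed over `F`, is the kernel of `valueMap₂`; the factor 2 is
  -- `[E : F]`.
  let T : V × V →ₗ[F] E ⊗[F] V := (TensorProduct.mk F E V 1).coprod (TensorProduct.mk F E V s)
  have hT : ∀ v w, T (v, w) = 1 ⊗ₜ v + s ⊗ₜ w := fun v w => by simp [T]
  have hfE : FiniteDimensional F E := FiniteDimensional.of_finrank_pos (by omega)
  have hsurj : Function.Surjective T := by
    intro t
    induction t using TensorProduct.induction_on with
    | zero => exact ⟨0, map_zero T⟩
    | tmul e v =>
      obtain ⟨a, b, rfl⟩ := hspan e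
      refine ⟨(a • v, b • v), ?_⟩
      rw [hT, TensorProduct.add_tmul, TensorProduct.smul_tmul, TensorProduct.smul_tmul]
    | add t t' ht ht' =>
      obtain ⟨p, rfl⟩ := ht
      obtain ⟨q, rfl⟩ := ht'
      exact ⟨p + q, _root_.map_add T p q⟩
  have hinj : Function.Injective T :=
    (LinearMap.injective_iff_surjective_of_finrank_eq_finrank (by
      rw [finrank_prod, finrank_tensorProduct, hE, two_mul])).2 hsurj
  have hval : ∀ v w, hφ.baseChange E (T (v, w)) = algebraMap F E (φ v + x * φ w) := by
    intro v w
    have hadd := (hφ.isTotallySingular_baseChange E).map_add (1 ⊗ₜ v) (s ⊗ₜ w)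
    rw [hT, hadd, hφ.baseChange_tmul E, hφ.baseChange_tmul E, hs, one_pow, one_mul,
      _root_.map_add, map_mul]
  have hval₂ : ∀ v w, hφ.valueMap₂ x (v, w) = toFrobenius F (φ v + x * φ w) := by
    intro v w
    rw [valueMap₂, LinearMap.coprod_apply, LinearMap.comp_apply, LinearMap.mulLeft_apply,
      hφ.valueMap_apply, hφ.valueMap_apply, _root_.map_add, map_mul]
  have hmap : (LinearMap.ker (hφ.valueMap₂ x)).map T =
      (hφ.baseChange E).radical.restrictScalars F := by
    ext t
    obtain ⟨⟨v, w⟩, rfl⟩ := hsurj t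
    rw [Submodule.restrictScalars_mem, (hφ.isTotallySingular_baseChange E).mem_radical, hval,
      map_eq_zero]
    constructor
    · rintro ⟨p, hp, e⟩
      rw [hinj e, SetLike.mem_coe, LinearMap.mem_ker, hval₂,
        map_eq_zero_iff _ (RingEquiv.injective _)] at hp
      exact hp
    · intro h0
      refine ⟨(v, w), ?_, rfl⟩
      rw [SetLike.mem_coe, LinearMap.mem_ker, hval₂, h0, map_zero]
  have h1 := (Submodule.equivMapOfInjective T hinj (LinearMap.ker (hφ.valueMap₂ x))).finrank_eq
  rw [h1, hmap, defect, ← hE]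
  exact finrank_mul_finrank_submodule _

/-- The extension stays in the universe of `F`, as the quantifier in `VishikEquivalent` requires. -/
theorem exists_quadratic_extension {F : Type u} [Field F] {x : F} (hx : ∀ y : F, y ^ 2 ≠ x) :
    ∃ (E : Type u) (_ : Field E) (_ : Algebra F E) (s : E), finrank F E = 2 ∧
      s ^ 2 = algebraMap F E x ∧ ∀ e : E, ∃ a b : F, e = a • 1 + b • s := by
  have hirr : Irreducible (Polynomial.X ^ 2 - Polynomial.C x) :=
    X_pow_sub_C_irreducible_of_prime Nat.prime_two hx
  have : Fact (Irreducible (Polynomial.X ^ 2 - Polynomial.C x)) := ⟨hirr⟩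
  have hmonic : (Polynomial.X ^ 2 - Polynomial.C x).Monic :=
    Polynomial.monic_X_pow_sub_C x two_ne_zero
  have hdeg : (Polynomial.X ^ 2 - Polynomial.C x).natDegree = 2 :=
    Polynomial.natDegree_X_pow_sub_C
  let pb := AdjoinRoot.powerBasis' hmonic
  have hdim : pb.dim = 2 := hdeg
  refine ⟨AdjoinRoot (Polynomial.X ^ 2 - Polynomial.C x), inferInstance, inferInstance,
    AdjoinRoot.root _, ?_, ?_, ?_⟩
  · rw [pb.finrank, hdim]
  · have := AdjoinRoot.eval₂_root (Polynomial.X ^ 2 - Polynomial.C x)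
    rw [Polynomial.eval₂_sub, Polynomial.eval₂_pow, Polynomial.eval₂_X, Polynomial.eval₂_C,
      sub_eq_zero] at this
    exact this
  · intro e
    let b := pb.basis.reindex (finCongr hdim)
    refine ⟨b.repr e 0, b.repr e 1, ?_⟩
    have h1 := b.sum_repr e
    have hb : ∀ i : Fin 2, b i = AdjoinRoot.root _ ^ (i : ℕ) := by
      intro i
      simp [b, pb]
    rw [Fin.sum_univ_two, hb, hb] at h1
    simpa using h1.symm

theorem VishikEquivalent.sameType [FiniteDimensional F V] [FiniteDimensional F W]
    {φ : QuadraticForm F V} {ψ : QuadraticForm F W} {hφ : IsTotallySingular φ}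
    {hψ : IsTotallySingular ψ} (h : VishikEquivalent hφ hψ) :
    SameType hφ.values hψ.values := by
  have hdef := h.2 F
  rw [hφ.defect_baseChange_self, hψ.defect_baseChange_self] at hdef
  have h1 := hφ.finrank_values_add_defect
  have h2 := hψ.finrank_values_add_defect
  have h3 := h.1
  have hrk : finrank F hφ.values = finrank F hψ.values := by omega
  refine ⟨hrk, fun x => ?_⟩
  obtain ⟨x, rfl⟩ := (toFrobenius F).surjective x
  -- A square `x` is a scalar of the Frobenius extension, so `selfInter x A = A` and only the
  -- dimension matters; a nonsquare gives a genuine quadratic extension.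
  by_cases hx : ∃ y : F, y ^ 2 = x
  · obtain ⟨y, rfl⟩ := hx
    have hself : ∀ A : Submodule F (FrobeniusField F),
        selfInter (toFrobenius F (y ^ 2)) A = A := fun A =>
      le_antisymm (selfInter_le _ _) fun a ha =>
        ⟨ha, mul_mem_of_mem_bot (mem_bot.2 ⟨y, algebraMap_frobeniusField y⟩) ha⟩
    rw [hself, hself, hrk]
  · push Not at hx
    have hx0 : x ≠ 0 := fun h0 => hx 0 (by rw [h0]; simp)
    obtain ⟨E, _, _, s, hE, hs, hspan⟩ := exists_quadratic_extension hx
    have h4 := hφ.two_mul_defect_baseChange hE hs hspan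
    have h5 := hψ.two_mul_defect_baseChange hE hs hspan
    rw [h.2 E] at h4
    have h6 := hφ.finrank_ker_valueMap₂ hx0
    have h7 := hψ.finrank_ker_valueMap₂ hx0
    omega

end Forms

end TotSing

theorem mainTheorem8 {F : Type u} {V : Type v} {W : Type w} [Field F] [CharP F 2]
    [AddCommGroup V] [Module F V] [FiniteDimensional F V]
    [AddCommGroup W] [Module F W] [FiniteDimensional F W]
    (φ : QuadraticForm F V) (ψ : QuadraticForm F W)
    (hφ : TotSing.IsTotallySingular φ) (hψ : TotSing.IsTotallySingular ψ)
    (hV : Module.finrank F V ≤ 5) (hW : Module.finrank F W ≤ 5)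
    (hv : TotSing.VishikEquivalent hφ hψ) :
    TotSing.Similar φ ψ := by
  exact hφ.similar_of_proportional hψ hv.1 (hv.sameType.proportional TotSing.exponentOne_frobeniusField
    (by have := hφ.finrank_values_add_defect; omega))
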